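/- **Problem.** A station has capacity $C$ and initial stock $s^{(0)}\in[0,C]$. At epochs $h=1,\dots,m$ it receives a net flow $d^{(h)}\in\mathbb R$. Vehicles $1,\dots,w$ ($w\ge 1$) visit it at epochs $1\le e_1<\dots<e_w\le m$; vehicle $i$ has capacity $Q_i$ and load $q_i\in[0,Q_i]$. An intervention vector $\mathbf x=[x_1,\dots,x_w]$ is feasible if $x_i\in[q_i-Q_i,q_i]$ for all $i$. It induces, for $h=1,\dots,m$, the virtual stock $\hat s^{(h)}=s^{(h-1)}+d^{(h)}+x_i$ if $h=e_i$ and $\hat s^{(h)}=s^{(h-1)}+d^{(h)}$ if $h$ is not a visit epoch, the losses $l^{(h)+}=\max(0,\hat s^{(h)}-C)$ and $l^{(h)-}=\max(0,-\hat s^{(h)})$, and the stock $s^{(h)}=\hat s^{(h)}-l^{(h)+}+l^{(h)-}$. The total loss is $L(\mathbf x)=\sum_{h=1}^m(l^{(h)+}+l^{(h)-})$. Put $e_{w+1}=m+1$, $I_i=[e_i,e_{i+1}-1]$, $J_i=[e_1,e_{i+1}-1]$ (so $J_0=\emptyset$), and let $L_{I_i}(\mathbf x)$, $L_{J_i}(\mathbf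 x)$ be the losses on these intervals. **Algorithm.** *Vehicle-Intervention*$(\underline e,\overline e,q,Q)$: start with $x^\infty=L^\infty=0$, $\alpha=+\infty$, $\beta=-\infty$; for $h=\underline e,\dots,\overline e$ set $\delta^+=\min(l^{(h)+},\alpha)$, $\delta^-=\min(l^{(h)-},C-\beta)$, $x^\infty\leftarrow x^\infty-\delta^++\delta^-$, $L^\infty\leftarrow L^\infty+(l^{(h)+}-\delta^+)+(l^{(h)-}-\delta^-)$, $\alpha\leftarrow\min(\alpha-\delta^+,s^{(h)})$, $\beta\leftarrow\max(\beta+\delta^-,s^{(h)})$, where $s,l^\pm$ are the stored arrays. Then $x^Q=q-Q$ if $x^\infty<q-Q$, $x^Q=q$ if $x^\infty>q$, and $x^Q=x^\infty$ otherwise; $L^Q=L^\infty+|x^\infty-x^Q|$. *Global-Backward-Recursive*$(i,\delta)$: let $\underline e=e_i$, $\overline e=e_{i+1}$. If $\delta>0$ set $d^{(\overline e)}=-s^{(\overline e-1)}-|\delta|$; if $\delta<0$ set $d^{(\overline e)}=C-s^{(\overline e-1)}+|\delta|$; in both cases recompute $\hat s^{(\overline e)},l^{(\overline e)\pm},s^{(\overline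 e)}$ for the null intervention; if $\delta=0$ replace $\overline e$ by $\overline e-1$. Compute $(x^Q,L^Q,x^\infty,L^\infty)=$ *Vehicle-Intervention*$(\underline e,\overline e,q_i,Q_i)$. If $i=1$, return $([x^Q],L^Q)$. If $i>1$, let $(\mathbf y,L)=$ *Global-Backward-Recursive*$(i-1,x^\infty-x^Q)$ and return $([\mathbf y,x^Q],L^\infty+L)$. *Global-Backward* computes the arrays $\hat s,l^\pm,s$ of the null vector $\mathbf 0$ on epochs $1,\dots,m$ and then returns $(\mathbf x^*,L^*)=$ *Global-Backward-Recursive*$(w,0)$. **Theorem.** For every instance with real data, Global-Backward returns a vector $\mathbf x^*$ such that: 1. $\mathbf x^*$ is feasible and minimizes $L$ over all feasible real vectors. It is also optimal for the backward formulation $\min_{x_1,\dots,x_{w-1}}\bigl(L_{J_{w-1}}+\min_{x_w}L_{I_w}\bigr)$. The returned value is $L^*=L_{J_w}(\mathbf x^*)$. 2. If all data $C,s^{(0)},d^{(h)},q_i,Q_i$ are integers, then $\mathbf x^*$ is an integer vector, and hence minimizes $L$ over all feasible integer vectors. 3. $s^{(m)}(\mathbf x^*)=s^{(m)}(\mathbf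 0)$. 4. The algorithm runs in $O(m)$ time: there is a universal constant $K$ such that on every instance it performs at most $K\,m$ steps, where every arithmetic operation, comparison, array access, loop test, loop increment and procedure call counts as one step. -/

import Mathlib

noncomputable section

namespace BikeStation

/-! ### The station, the vehicles and the optimization problem -/

/-- A problem instance. Epochs are `1, …, m` and vehicles are `1, …, w`; the functions `d`, `e`, `q`,
`Q` are only meaningful on these ranges. -/
structure Problem where
  /-- number of epochs -/
  m : ℕ
  /-- number of vehicles -/
  w : ℕ
  /-- station capacity -/
  C : ℝ
  /-- initial stock level -/
  s₀ : ℝ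
  /-- system flow -/
  d : ℕ → ℝ
  /-- visit epochs -/
  e : ℕ → ℕ
  /-- vehicle loads -/
  q : ℕ → ℝ
  /-- vehicle capacities -/
  Q : ℕ → ℝ
  one_le_w : 1 ≤ w
  s₀_mem : s₀ ∈ Set.Icc 0 C
  e_mem : ∀ i ∈ Finset.Icc 1 w, e i ∈ Finset.Icc 1 m
  e_lt : ∀ i, 1 ≤ i → i < w → e i < e (i + 1)
  q_mem : ∀ i ∈ Finset.Icc 1 w, q i ∈ Set.Icc 0 (Q i)

namespace Problem

variable (P : Problem)

/-- The amount moved into the station at epoch `h` under the intervention vector `x`: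
it is `x i` if `h = e i` for a vehicle `i`, and `0` if `h` is not a visit epoch. -/
def interventionAt (x : ℕ → ℝ) (h : ℕ) : ℝ :=
  ∑ i ∈ Finset.Icc 1 P.w with P.e i = h, x i

/-- The stock level after epoch `h`: virtual stock minus surplus loss plus stockout loss. -/
def stock (x : ℕ → ℝ) : ℕ → ℝ
  | 0 => P.s₀
  | h + 1 =>
    let v := stock x h + P.d (h + 1) + P.interventionAt x (h + 1)
    v - max 0 (v - P.C) + max 0 (-v)

/-- The virtual stock at epoch `h ≥ 1`. -/
def virtualStock (x : ℕ → ℝ) (h : ℕ) : ℝ :=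
  P.stock x (h - 1) + P.d h + P.interventionAt x h

/-- The surplus loss at epoch `h ≥ 1`. -/
def surplusLoss (x : ℕ → ℝ) (h : ℕ) : ℝ := max 0 (P.virtualStock x h - P.C)

/-- The stockout loss at epoch `h ≥ 1`. -/
def stockoutLoss (x : ℕ → ℝ) (h : ℕ) : ℝ := max 0 (-P.virtualStock x h)

/-- The loss on the epochs `a, …, b`. -/
def lossOn (a b : ℕ) (x : ℕ → ℝ) : ℝ :=
  ∑ h ∈ Finset.Icc a b, (P.surplusLoss x h + P.stockoutLoss x h)

/-- The total loss `L(x)`. -/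
def totalLoss (x : ℕ → ℝ) : ℝ := P.lossOn 1 P.m x

/-- The last epoch of the intervals `I i` and `J i`. -/
def lastEpoch (i : ℕ) : ℕ := if i < P.w then P.e (i + 1) - 1 else P.m

/-- The loss on `I i = [e i, …, e (i+1) - 1]` (up to `m` if `i = w`). -/
def lossI (i : ℕ) (x : ℕ → ℝ) : ℝ := P.lossOn (P.e i) (P.lastEpoch i) x

/-- The loss on `J i = [e 1, …, e (i+1) - 1]` (up to `m` if `i = w`); `J 0` is empty. -/
def lossJ (i : ℕ) (x : ℕ → ℝ) : ℝ := P.lossOn (P.e 1) (P.lastEpoch i) x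

/-- The feasible amounts for vehicle `i`. -/
def Admissible (i : ℕ) (t : ℝ) : Prop := t ∈ Set.Icc (P.q i - P.Q i) (P.q i)

/-- Feasible intervention vectors (without integrality). -/
def Feasible (x : ℕ → ℝ) : Prop := ∀ i ∈ Finset.Icc 1 P.w, P.Admissible i (x i)

/-- The entries of an intervention vector are integers. -/
def IntegerVector (x : ℕ → ℝ) : Prop := ∀ i ∈ Finset.Icc 1 P.w, ∃ z : ℤ, x i = z

/-- All data of the problem are integers. -/
def IntegerData : Prop :=
  (∃ z : ℤ, P.C = z) ∧ (∃ z : ℤ, P.s₀ = z) ∧ (∀ h ∈ Finset.Icc 1 P.m, ∃ z : ℤ, P.d h = z) ∧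
    ∀ i ∈ Finset.Icc 1 P.w, (∃ z : ℤ, P.q i = z) ∧ ∃ z : ℤ, P.Q i = z

/-- `x` minimizes the total loss over all feasible real vectors (the linear relaxation). -/
def IsOptimal (x : ℕ → ℝ) : Prop :=
  P.Feasible x ∧ ∀ y, P.Feasible y → P.totalLoss x ≤ P.totalLoss y

/-- `x` minimizes the total loss over all feasible integer vectors (the integer program). -/
def IsIntegerOptimal (x : ℕ → ℝ) : Prop :=
  (P.Feasible x ∧ P.IntegerVector x) ∧
    ∀ y, P.Feasible y → P.IntegerVector y → P.totalLoss x ≤ P.totalLoss y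

/-- The last entry of `x` attains the inner minimum `min_{x_w} L_{I w}` of the backward formulation,
the earlier entries being those of `x`. -/
def LastOptimal (x : ℕ → ℝ) : Prop :=
  P.Admissible P.w (x P.w) ∧
    ∀ t, P.Admissible P.w t → P.lossI P.w x ≤ P.lossI P.w (Function.update x P.w t)

/-- `x` is optimal for the backward formulation
`min_{x_1, …, x_{w-1}} (L_{J (w-1)} + min_{x_w} L_{I w})`. -/
def IsBackwardOptimal (x : ℕ → ℝ) : Prop :=
  (P.Feasible x ∧ P.LastOptimal x) ∧
    ∀ y, P.Feasible y → P.LastOptimal y →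
      P.lossJ (P.w - 1) x + P.lossI P.w x ≤ P.lossJ (P.w - 1) y + P.lossI P.w y

end Problem

/-! ### A unit-cost random access machine over the reals

The algorithms below are written in a monad that counts steps. They compute only through the
primitives `op` (one arithmetic operation or one comparison), the `read…` and `write…` operations
(one access to an array cell), `forLoop` and `call`, each of which is charged. -/

/-- The memory: the global arrays. -/
structure Store where
  /-- system flow -/
  d : ℕ → ℝ
  /-- decision epochs -/
  H : ℕ → ℕ
  /-- vehicle loads -/
  q : ℕ → ℝ
  /-- vehicle capacities -/
  Q : ℕ → ℝ
  /-- virtual stock -/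
  v : ℕ → ℝ
  /-- surplus losses -/
  lp : ℕ → ℝ
  /-- stockout losses -/
  lm : ℕ → ℝ
  /-- stock levels -/
  s : ℕ → ℝ
  /-- intervention vector -/
  x : ℕ → ℝ

/-- The outcome of a computation. -/
structure Result (α : Type) where
  /-- returned value -/
  val : α
  /-- final memory -/
  mem : Store
  /-- number of steps -/
  cost : ℕ

/-- Computations that act on the memory and count their steps. -/
def RAM (α : Type) : Type := Store → Result α

namespace RAM

instance : Monad RAM where
  pure a := fun σ => ⟨a, σ, 0⟩
  bind p f := fun σ =>
    let r₁ := p σ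
    let r₂ := f r₁.val r₁.mem
    ⟨r₂.val, r₂.mem, r₁.cost + r₂.cost⟩

/-- One arithmetic operation or comparison on registers. -/
def op {α : Type} (a : α) : RAM α := fun σ => ⟨a, σ, 1⟩

/-- One step without effect on the memory. -/
def tick : RAM Unit := op ()

def readD (i : ℕ) : RAM ℝ := fun σ => ⟨σ.d i, σ, 1⟩
def readH (i : ℕ) : RAM ℕ := fun σ => ⟨σ.H i, σ, 1⟩
def readq (i : ℕ) : RAM ℝ := fun σ => ⟨σ.q i, σ, 1⟩
def readQ (i : ℕ) : RAM ℝ := fun σ => ⟨σ.Q i, σ, 1⟩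
def readLp (i : ℕ) : RAM ℝ := fun σ => ⟨σ.lp i, σ, 1⟩
def readLm (i : ℕ) : RAM ℝ := fun σ => ⟨σ.lm i, σ, 1⟩
def readS (i : ℕ) : RAM ℝ := fun σ => ⟨σ.s i, σ, 1⟩

def writeD (i : ℕ) (a : ℝ) : RAM Unit := fun σ => ⟨(), { σ with d := Function.update σ.d i a }, 1⟩
def writeH (i : ℕ) (a : ℕ) : RAM Unit := fun σ => ⟨(), { σ with H := Function.update σ.H i a }, 1⟩
def writeV (i : ℕ) (a : ℝ) : RAM Unit := fun σ => ⟨(), { σ with v := Function.update σ.v i a }, 1⟩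
def writeLp (i : ℕ) (a : ℝ) : RAM Unit := fun σ => ⟨(), { σ with lp := Function.update σ.lp i a }, 1⟩
def writeLm (i : ℕ) (a : ℝ) : RAM Unit := fun σ => ⟨(), { σ with lm := Function.update σ.lm i a }, 1⟩
def writeS (i : ℕ) (a : ℝ) : RAM Unit := fun σ => ⟨(), { σ with s := Function.update σ.s i a }, 1⟩
def writeX (i : ℕ) (a : ℝ) : RAM Unit := fun σ => ⟨(), { σ with x := Function.update σ.x i a }, 1⟩

/-- `n` rounds of a counting loop starting at `h`; every round is charged for the loop test and the
increment of the counter, and leaving the loop for the last loop test. -/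
def rounds {α : Type} (body : ℕ → α → RAM α) : ℕ → ℕ → α → RAM α
  | 0, _, a => do
    tick
    pure a
  | n + 1, h, a => do
    tick
    let b ← body h a
    tick
    rounds body n (h + 1) b

/-- `for (h = lo; h ≤ hi; h++)`, where `a` is the initial value of the variables changed by the
body. -/
def forLoop {α : Type} (lo hi : ℕ) (a : α) (body : ℕ → α → RAM α) : RAM α :=
  rounds body (hi + 1 - lo) lo a

/-- A procedure call. -/
def call {α : Type} (p : RAM α) : RAM α := do
  tick
  p

end RAM

open RAM

/-! ### The algorithms -/

/-- Variables of the scan in `Vehicle-Intervention`: the current intervention, the loss counter, and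
the trackers `α` and `β` of the minimum and the maximum stock level, which start at `+∞` and `-∞`. -/
structure Scan where
  x : ℝ
  L : ℝ
  α : EReal
  β : EReal

/-- The output of `Vehicle-Intervention`. -/
structure InterventionOutput where
  xQ : ℝ
  LQ : ℝ
  xInf : ℝ
  LInf : ℝ

/-- The body of the scan in `Vehicle-Intervention`. The numbers `δp` and `δm` are always finite. -/
def scanBody (C : ℝ) (h : ℕ) (a : Scan) : RAM Scan := do
  let lp ← readLp h
  let lm ← readLm h
  let s ← readS h
  let δp ← op (min (lp : EReal) a.α).toReal
  let r ← op ((C : EReal) - a.β)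
  let δm ← op (min (lm : EReal) r).toReal
  let x₁ ← op (a.x - δp)
  let x₂ ← op (x₁ + δm)
  let up ← op (lp - δp)
  let um ← op (lm - δm)
  let L₁ ← op (a.L + up)
  let L₂ ← op (L₁ + um)
  let α₁ ← op (a.α - (δp : EReal))
  let α₂ ← op (min α₁ (s : EReal))
  let β₁ ← op (a.β + (δm : EReal))
  let β₂ ← op (max β₁ (s : EReal))
  pure ⟨x₂, L₂, α₂, β₂⟩

/-- Algorithm `Vehicle-Intervention`. -/
def vehicleIntervention (C : ℝ) (lo hi : ℕ) (q Q : ℝ) : RAM InterventionOutput := do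
  let a ← forLoop lo hi ⟨0, 0, ⊤, ⊥⟩ (scanBody C)
  let b ← op (q - Q)
  let c₁ ← op (decide (a.x < b))
  if c₁ then do
    let t ← op (a.L + b)
    let LQ ← op (t - a.x)
    pure ⟨b, LQ, a.x, a.L⟩
  else do
    let c₂ ← op (decide (q < a.x))
    if c₂ then do
      let t ← op (a.L + a.x)
      let LQ ← op (t - q)
      pure ⟨q, LQ, a.x, a.L⟩
    else
      pure ⟨a.x, a.L, a.x, a.L⟩

/-- Computes virtual stock, losses and stock level of the null intervention at epoch `h`. -/
def nullStep (C : ℝ) (h : ℕ) : RAM Unit := do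
  let k ← op (h - 1)
  let s ← readS k
  let d ← readD h
  let v ← op (s + d)
  writeV h v
  let t ← op (v - C)
  let lp ← op (max 0 t)
  writeLp h lp
  let u ← op (-v)
  let lm ← op (max 0 u)
  writeLm h lm
  let s₁ ← op (v - lp)
  let s₂ ← op (s₁ + lm)
  writeS h s₂

/-- The augmentation step of `Global-Backward-Recursive`, which also returns the last epoch of the
interval to be optimized. If `δ ≠ 0`, the demand at epoch `hi` is set so that the null vector has
there a stockout loss `|δ|` (if `δ > 0`) or a surplus loss `|δ|` (if `δ < 0`), and the data of the
null intervention at `hi` are updated accordingly. -/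
def augment (C : ℝ) (hi : ℕ) (δ : ℝ) : RAM ℕ := do
  let k ← op (hi - 1)
  let c₁ ← op (decide (0 < δ))
  if c₁ then do
    let s ← readS k
    let t ← op (-s)
    let a ← op |δ|
    let d ← op (t - a)
    writeD hi d
    call (nullStep C hi)
    pure hi
  else do
    let c₂ ← op (decide (δ < 0))
    if c₂ then do
      let s ← readS k
      let t ← op (C - s)
      let a ← op |δ|
      let d ← op (t + a)
      writeD hi d
      call (nullStep C hi)
      pure hi
    else
      pure k

/-- Algorithm `Global-Backward-Recursive` at stage `i ≥ 1` with augmentation `δ`. The vector is built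
in the array `x`: appending the intervention of stage `i` to the vector of the first `i - 1` stages
is one array access. The returned value is `L*`. Stage `0` is never called. -/
def globalBackwardRec (C : ℝ) : ℕ → ℝ → RAM ℝ
  | 0, _ => pure 0
  | j + 1, δ => do
    let lo ← readH (j + 1)
    let i' ← op (j + 1 + 1)
    let top ← readH i'
    let hi ← augment C top δ
    let q ← readq (j + 1)
    let Q ← readQ (j + 1)
    let r ← call (vehicleIntervention C lo hi q Q)
    let c ← op (decide (1 < j + 1))
    if c then do
      let δ' ← op (r.xInf - r.xQ)
      let _ ← op (j + 1 - 1)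
      let L ← call (globalBackwardRec C j δ')
      writeX (j + 1) r.xQ
      let L' ← op (r.LInf + L)
      pure L'
    else do
      writeX (j + 1) r.xQ
      pure r.LQ

/-- Algorithm `Global-Backward`; the output vector is left in the array `x` and the returned value
is `L*`. -/
def globalBackward (m w : ℕ) (C s₀ : ℝ) : RAM ℝ := do
  let k ← op (w + 1)
  let l ← op (m + 1)
  writeH k l
  writeS 0 s₀
  forLoop 1 m () (fun h _ => nullStep C h)
  call (globalBackwardRec C w 0)

/-- The memory contains the input arrays of the problem; the other arrays are arbitrary. -/
def Store.Holds (σ : Store) (P : Problem) : Prop :=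
  (∀ h ∈ Finset.Icc 1 P.m, σ.d h = P.d h) ∧
    ∀ i ∈ Finset.Icc 1 P.w, σ.H i = P.e i ∧ σ.q i = P.q i ∧ σ.Q i = P.Q i

end BikeStation

end

/-!
Between two visits the stock evolves by translations and by projections to `[0, C]`. As a function
of the initial amount `t`, the stock before the interval plus the intervention, the final stock is
therefore the projection of `t` to some interval followed by a translation, and the loss is a
constant plus the distance of `t` from that interval. `Tracks` says that the scan of
Vehicle-Intervention maintains this interval, seen from the projection `t₀ + x` of the amount `t₀`
of the null vector; this is an invariant under one more epoch (`Tracks.step`), and it makes `x` the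
smallest change of `t₀` that minimizes the loss (`Tracks.improves`).

An augmented epoch with request `δ` adds to the loss the part of `δ` by which the stock fails to
differ from the null stock (`shortfall`). It penalizes deviation on one side only. This is enough,
because `0` is always feasible for a vehicle: the truncated intervention lies between `0` and `x`,
so the stock never leaves the segment from the null stock to the null stock plus the request
(`Improves.attained`). If the capacity truncates `x`, the remainder is exactly what the earlier
vehicles are asked for, and missing one unit of it costs one unit of loss, for every intervention of
the vehicle (`Improves.add_shortfall_le`). Hence each stage is solved exactly (`SolvesStage.succ`),
and the recursion by induction (`globalBackwardRec_solves`). Without a request at the last stage,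
the final stock is that of the null vector.

Integrality holds because the computation stays inside every subgroup of `ℝ` that contains the data.
The running time is linear because the scan of a stage exceeds the interval of that stage by at most
one epoch.
-/

namespace BikeStation
open RAM

/-! ### Clipping and the invariant of the scan -/

/-- The stock level that results from the virtual stock `v`: the projection of `v` to `[0, C]`. -/
def clip (C v : ℝ) : ℝ := v - max 0 (v - C) + max 0 (-v)

/-- The loss at virtual stock `v`: the distance of `v` from `[0, C]`. -/
def clipLoss (C v : ℝ) : ℝ := max 0 (v - C) + max 0 (-v)

theorem clip_mem {C : ℝ} (hC : 0 ≤ C) (v : ℝ) : clip C v ∈ Set.Icc 0 C := by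
  unfold clip
  constructor <;>
    rcases max_cases 0 (v - C) with ⟨h, _⟩ | ⟨h, _⟩ <;>
    rcases max_cases 0 (-v) with ⟨h', _⟩ | ⟨h', _⟩ <;> rw [h, h'] <;> linarith

theorem clip_mono {C : ℝ} (hC : 0 ≤ C) : Monotone (clip C) := by
  intro v v' hv
  unfold clip
  rcases max_cases 0 (v - C) with ⟨h, _⟩ | ⟨h, _⟩ <;>
    rcases max_cases 0 (-v) with ⟨h', _⟩ | ⟨h', _⟩ <;>
    rcases max_cases 0 (v' - C) with ⟨k, _⟩ | ⟨k, _⟩ <;>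
    rcases max_cases 0 (-v') with ⟨k', _⟩ | ⟨k', _⟩ <;> rw [h, h', k, k'] <;> linarith

theorem clip_of_nonneg_of_le {C v : ℝ} (h₀ : 0 ≤ v) (h₁ : v ≤ C) : clip C v = v := by
  rw [clip, max_eq_left (by linarith), max_eq_left (by linarith)]; ring

theorem clip_of_le {C v : ℝ} (hC : 0 ≤ C) (h : C ≤ v) : clip C v = C := by
  rw [clip, max_eq_right (by linarith), max_eq_left (by linarith)]; ring

theorem clip_of_nonpos {C v : ℝ} (hC : 0 ≤ C) (h : v ≤ 0) : clip C v = 0 := by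
  rw [clip, max_eq_left (by linarith), max_eq_right (by linarith)]; ring

/-- The scan reached the values `x`, `L`, `α`, `β` on an interval which turns the initial amount `t`
(the stock before the interval plus the intervention) into the final stock `S t` at the loss `F t`,
and the initial amount `t₀` into `s`. On such an interval `S` is a projection to an interval
followed by a translation, and `F` is a constant plus the distance to the same interval; the
trackers describe that interval relative to the projection `t₀ + x` of `t₀`: it reaches down by `α`
and up by `C - β`. -/
structure Tracks (C t₀ : ℝ) (S F : ℝ → ℝ) (s x L α β : ℝ) : Prop where
  α_nonneg : 0 ≤ α
  β_le : β ≤ C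
  start : S t₀ = s
  stock : ∀ y, S (t₀ + x + y) = s + max (-α) (min y (C - β))
  loss : ∀ y, F (t₀ + x + y) = L + max 0 (max (y - (C - β)) (-α - y))

/-- After its first epoch, the scan, whose trackers start at infinity, describes a real interval. -/
theorem Tracks.first {C : ℝ} (hC : 0 ≤ C) (t₀ d : ℝ) :
    Tracks C t₀ (fun t => clip C (t + d)) (fun t => clipLoss C (t + d)) (clip C (t₀ + d))
      (-max 0 (t₀ + d - C) + max 0 (-(t₀ + d))) 0 (clip C (t₀ + d)) (clip C (t₀ + d)) := by
  have hs := clip_mem hC (t₀ + d)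
  have key : ∀ y, t₀ + (-max 0 (t₀ + d - C) + max 0 (-(t₀ + d))) + y + d
      = clip C (t₀ + d) + y := fun y => by unfold clip; ring
  refine ⟨hs.1, hs.2, rfl, fun y => ?_, fun y => ?_⟩ <;> simp only [key] <;>
    generalize clip C (t₀ + d) = s at hs <;> obtain ⟨h0, h1⟩ := hs
  · unfold clip
    grind
  · unfold clipLoss
    grind

/-- The update of the scan at an epoch with demand `d`. A loss of the null vector is avoided as far
as the tracked interval permits; if it does not suffice, the interval shrinks to its end point. -/
theorem Tracks.step {C t₀ : ℝ} {S F : ℝ → ℝ} {s x L α β : ℝ} (hC : 0 ≤ C)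
    (h : Tracks C t₀ S F s x L α β) (d : ℝ) {lp lm : ℝ} (hlp : lp = max 0 (s + d - C))
    (hlm : lm = max 0 (-(s + d))) :
    Tracks C t₀ (fun t => clip C (S t + d)) (fun t => F t + clipLoss C (S t + d)) (clip C (s + d))
      (x - min lp α + min lm (C - β)) (L + (lp - min lp α) + (lm - min lm (C - β)))
      (min (α - min lp α) (clip C (s + d))) (max (β + min lm (C - β)) (clip C (s + d))) := by
  obtain ⟨hα, hβ, h₀, hS, hF⟩ := h
  have hs := clip_mem hC (s + d)
  have shift : ∀ y, t₀ + (x - min lp α + min lm (C - β)) + y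
      = t₀ + x + (y - min lp α + min lm (C - β)) := fun y => by ring
  refine ⟨?_, ?_, by simp only [h₀], fun y => ?_, fun y => ?_⟩
  · exact le_min (sub_nonneg.2 (min_le_right _ _)) hs.1
  · exact max_le (by linarith [min_le_right lm (C - β)]) hs.2
  · simp only [shift, hS, add_right_comm s _ d]
    clear hS hF hs shift
    generalize s + d = v at *
    rcases le_total v 0 with hv | hv
    · rw [max_eq_left (by linarith)] at hlp
      rw [max_eq_right (by linarith)] at hlm
      rw [clip_of_nonpos hC hv, hlp, hlm]
      unfold clip
      grind
    rcases le_total C v with hv' | hv'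
    · rw [max_eq_right (by linarith)] at hlp
      rw [max_eq_left (by linarith)] at hlm
      rw [clip_of_le hC hv', hlp, hlm]
      unfold clip
      grind
    · rw [max_eq_left (by linarith)] at hlp
      rw [max_eq_left (by linarith)] at hlm
      rw [clip_of_nonneg_of_le hv hv', hlp, hlm, min_eq_left hα,
        min_eq_left (sub_nonneg.2 hβ)]
      unfold clip
      grind
  · simp only [shift, hS, hF, add_right_comm s _ d]
    clear hS hF hs shift
    generalize s + d = v at *
    rcases le_total v 0 with hv | hv
    · rw [max_eq_left (by linarith)] at hlp
      rw [max_eq_right (by linarith)] at hlm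
      rw [clip_of_nonpos hC hv, hlp, hlm]
      unfold clipLoss
      grind
    rcases le_total C v with hv' | hv'
    · rw [max_eq_right (by linarith)] at hlp
      rw [max_eq_left (by linarith)] at hlm
      rw [clip_of_le hC hv', hlp, hlm]
      unfold clipLoss
      grind
    · rw [max_eq_left (by linarith)] at hlp
      rw [max_eq_left (by linarith)] at hlm
      rw [clip_of_nonneg_of_le hv hv', hlp, hlm, min_eq_left hα,
        min_eq_left (sub_nonneg.2 hβ)]
      unfold clipLoss
      grind

/-! ### Requests and capacities -/

/-- The loss at an augmented epoch whose demand asks for the stock to differ by `δ` from the null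
stock, when it actually differs by `z`: only the part of `δ` that is missing counts. -/
noncomputable def shortfall (δ z : ℝ) : ℝ :=
  if 0 < δ then max 0 (δ - z) else if δ < 0 then max 0 (z - δ) else 0

theorem shortfall_zero (z : ℝ) : shortfall 0 z = 0 := by simp [shortfall]

theorem shortfall_at_zero (δ : ℝ) : shortfall δ 0 = |δ| := by
  unfold shortfall
  split_ifs with h h'
  · rw [sub_zero, max_eq_right h.le, abs_of_pos h]
  · rw [zero_sub, max_eq_right (by linarith), abs_of_neg h']
  · rw [le_antisymm (not_lt.1 h) (not_lt.1 h'), abs_zero]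

/-- What optimality needs to know about the loss `F t` of an interval as a function of the initial
amount `t`: changing the null amount `t₀` by `x` attains the minimum `L`, on the way from `t₀` to
`t₀ + x` the loss exceeds `L` by the missing amount, and on the side of `t₀` it grows at least at
that rate. -/
structure Improves (t₀ : ℝ) (F : ℝ → ℝ) (x L : ℝ) : Prop where
  le : ∀ t, L ≤ F t
  of_pos : 0 < x → ∀ t, L + (t₀ + x - t) ≤ F t
  of_neg : x < 0 → ∀ t, L + (t - (t₀ + x)) ≤ F t
  eq : ∀ t ∈ Set.uIcc t₀ (t₀ + x), F t = L + |t₀ + x - t|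

/-- Since the projection of `t₀` is `t₀ + x`, the tracked interval ends at `t₀ + x` on the side
of `t₀`. -/
theorem Tracks.α_eq_zero {C t₀ : ℝ} {S F : ℝ → ℝ} {s x L α β : ℝ}
    (h : Tracks C t₀ S F s x L α β) (hx : 0 < x) : α = 0 := by
  have := h.stock (-x)
  rw [add_neg_cancel_right, h.start] at this
  have h₁ := h.α_nonneg
  have h₂ := h.β_le
  rw [min_eq_left (by linarith)] at this
  rcases max_cases (-α) (-x) with ⟨h, _⟩ | ⟨h, _⟩ <;> linarith

theorem Tracks.β_eq {C t₀ : ℝ} {S F : ℝ → ℝ} {s x L α β : ℝ}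
    (h : Tracks C t₀ S F s x L α β) (hx : x < 0) : β = C := by
  have := h.stock (-x)
  rw [add_neg_cancel_right, h.start] at this
  have h₁ := h.α_nonneg
  have h₂ := h.β_le
  rw [max_eq_right (le_min (by linarith) (by linarith))] at this
  rcases min_cases (-x) (C - β) with ⟨h, _⟩ | ⟨h, _⟩ <;> linarith

/-- The smallest change of `t₀` into the tracked interval minimizes the distance from it. -/
theorem Tracks.improves {C t₀ : ℝ} {S F : ℝ → ℝ} {s x L α β : ℝ}
    (h : Tracks C t₀ S F s x L α β) : Improves t₀ F x L := by
  have key : ∀ t, F t = L + max 0 (max (t - t₀ - x - (C - β)) (-α - (t - t₀ - x))) := fun t => by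
    rw [← h.loss]; congr 1; ring
  have h₁ := h.α_nonneg
  have h₂ := h.β_le
  refine ⟨fun t => ?_, fun hx t => ?_, fun hx t => ?_, fun t ht => ?_⟩
  · rw [key]; linarith [le_max_left 0 (max (t - t₀ - x - (C - β)) (-α - (t - t₀ - x)))]
  · rw [key, h.α_eq_zero hx]
    have := (le_max_right (t - t₀ - x - (C - β)) (-0 - (t - t₀ - x))).trans (le_max_right 0 _)
    linarith
  · rw [key, h.β_eq hx]
    have := (le_max_left (t - t₀ - x - (C - C)) (-α - (t - t₀ - x))).trans (le_max_right 0 _)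
    linarith
  · rw [key]
    rcases lt_trichotomy x 0 with hx | hx | hx
    · rw [Set.uIcc_of_ge (by linarith)] at ht
      rw [h.β_eq hx, abs_of_nonpos (by linarith [ht.1]), max_eq_left (b := -α - _),
        max_eq_right] <;> linarith [ht.1]
    · rw [hx, add_zero, Set.uIcc_self] at ht
      rw [ht, hx, max_eq_left (max_le (by linarith) (by linarith))]; simp
    · rw [Set.uIcc_of_le (by linarith)] at ht
      rw [h.α_eq_zero hx, abs_of_nonneg (by linarith [ht.2]), max_eq_right (a := _ - (C - β)),
        max_eq_right] <;> linarith [ht.2]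

/-- All amounts from `t₀` to its projection `t₀ + x` lead to the same final stock. -/
theorem Tracks.stock_eq {C t₀ : ℝ} {S F : ℝ → ℝ} {s x L α β : ℝ}
    (h : Tracks C t₀ S F s x L α β) (hS : Monotone S) {t : ℝ} (ht : t ∈ Set.uIcc t₀ (t₀ + x)) :
    S t = s := by
  have hx : S (t₀ + x) = s := by
    have := h.stock 0
    rw [add_zero, min_eq_left (by linarith [h.β_le]), max_eq_right (by linarith [h.α_nonneg]),
      add_zero] at this
    exact this
  have := hS.mapsTo_uIcc ht
  rwa [h.start, hx, Set.uIcc_self] at this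

section Augmentation
variable {C t₀ : ℝ} {S F : ℝ → ℝ} {s x L α β : ℝ}

/-- The scan of an augmented epoch at which the null vector has the stockout loss `δ`. -/
theorem Tracks.augment_pos (h : Tracks C t₀ S F s x L α β) (hS : Monotone S)
    (hm : ∀ t, S t ∈ Set.Icc 0 C) {δ : ℝ} (hδ : 0 < δ) :
    Improves t₀ (fun t => F t + shortfall δ (S t - s)) (x + min δ (C - β))
        (L + (δ - min δ (C - β))) ∧
      ∀ t ∈ Set.uIcc t₀ (t₀ + (x + min δ (C - β))), S t ∈ Set.uIcc s (s + δ) := by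
  have hs : s ∈ Set.Icc 0 C := h.start ▸ hm t₀
  have hC := hs.1.trans hs.2
  have hδ₀ : 0 ≤ min δ (C - β) := le_min hδ.le (sub_nonneg.2 h.β_le)
  constructor
  · have h' := (h.step hC (-s - δ) (lp := 0) (lm := δ) (by rw [max_eq_left]; linarith)
      (by rw [max_eq_right] <;> linarith)).improves
    rw [min_eq_left h.α_nonneg] at h'
    have hF : (fun t => F t + shortfall δ (S t - s)) =
        fun t => F t + clipLoss C (S t + (-s - δ)) := by
      funext t
      have ht := hm t
      rw [clipLoss, shortfall, if_pos hδ, max_eq_left (b := _ - C) (by linarith [ht.2, hs.1]),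
        zero_add, show δ - (S t - s) = -(S t + (-s - δ)) by ring]
    rw [hF]
    simpa using h'
  · intro t ht
    have h₁ := h.stock (min δ (C - β))
    rw [min_eq_left (min_le_right _ _), max_eq_right (by linarith [h.α_nonneg])] at h₁
    have h₂ := hS.mapsTo_uIcc ht
    rw [h.start, ← add_assoc, h₁, Set.uIcc_of_le (by linarith)] at h₂
    rw [Set.uIcc_of_le (by linarith)]
    exact ⟨h₂.1, h₂.2.trans (by linarith [min_le_left δ (C - β)])⟩

/-- The scan of an augmented epoch at which the null vector has the surplus loss `-δ`. -/
theorem Tracks.augment_neg (h : Tracks C t₀ S F s x L α β) (hS : Monotone S)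
    (hm : ∀ t, S t ∈ Set.Icc 0 C) {δ : ℝ} (hδ : δ < 0) :
    Improves t₀ (fun t => F t + shortfall δ (S t - s)) (x - min (-δ) α)
        (L + (-δ - min (-δ) α)) ∧
      ∀ t ∈ Set.uIcc t₀ (t₀ + (x - min (-δ) α)), S t ∈ Set.uIcc s (s + δ) := by
  have hs : s ∈ Set.Icc 0 C := h.start ▸ hm t₀
  have hC := hs.1.trans hs.2
  have hδ₀ : 0 ≤ min (-δ) α := le_min (by linarith) h.α_nonneg
  constructor
  · have h' := (h.step hC (C - s - δ) (lp := -δ) (lm := 0) (by rw [max_eq_right] <;> linarith)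
      (by rw [max_eq_left]; linarith)).improves
    rw [min_eq_left (sub_nonneg.2 h.β_le)] at h'
    have hF : (fun t => F t + shortfall δ (S t - s)) =
        fun t => F t + clipLoss C (S t + (C - s - δ)) := by
      funext t
      have ht := hm t
      rw [clipLoss, shortfall, if_neg hδ.not_gt, if_pos hδ,
        max_eq_left (b := -(_ + _)) (by linarith [ht.1, hs.2]), add_zero,
        show S t - s - δ = S t + (C - s - δ) - C by ring]
    rw [hF]
    simpa using h'
  · intro t ht
    have h₁ := h.stock (-min (-δ) α)
    rw [min_eq_left (b := C - β) (by linarith [h.β_le]),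
      max_eq_right (by linarith [min_le_right (-δ) α])] at h₁
    have h₂ := hS.mapsTo_uIcc ht
    rw [h.start, sub_eq_add_neg, ← add_assoc, h₁, Set.uIcc_of_ge (by linarith)] at h₂
    rw [Set.uIcc_of_ge (by linarith)]
    exact ⟨le_trans (by linarith [min_le_left (-δ) α]) h₂.1, h₂.2⟩

end Augmentation

section Capacity
variable {t₀ : ℝ} {F : ℝ → ℝ} {x L q Q : ℝ}

/-- The amount that the capacity of a vehicle leaves over from the intervention `x`, and that
the earlier vehicles are asked for, bounds the loss of the interval from below. -/
theorem Improves.add_shortfall_le (h : Improves t₀ F x L) (h₀ : (0 : ℝ) ∈ Set.Icc (q - Q) q)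
    (u : ℝ) {ξ : ℝ} (hξ : ξ ∈ Set.Icc (q - Q) q) :
    L + shortfall (x - max (q - Q) (min x q)) (u - t₀) ≤ F (u + ξ) := by
  have h₁ := h.le (u + ξ)
  unfold shortfall
  split_ifs with hp hn
  · have hq : q < x := by
      by_contra hc
      rw [min_eq_left (not_lt.1 hc)] at hp
      linarith [le_max_right (q - Q) x]
    have h₂ := h.of_pos (h₀.2.trans_lt hq) (u + ξ)
    rw [min_eq_right hq.le, max_eq_right (h₀.1.trans h₀.2)]
    rcases max_cases 0 (x - q - (u - t₀)) with ⟨e, _⟩ | ⟨e, _⟩ <;> rw [e] <;> linarith [hξ.2]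
  · have hq : x < q - Q := by
      by_contra hc
      rw [max_eq_right (le_min (not_lt.1 hc) (h₀.1.trans h₀.2))] at hn
      linarith [min_le_left x q]
    have h₂ := h.of_neg (hq.trans_le h₀.1) (u + ξ)
    rw [min_eq_left (by linarith [h₀.1, h₀.2]), max_eq_left hq.le]
    rcases max_cases 0 (u - t₀ - (x - (q - Q))) with ⟨e, _⟩ | ⟨e, _⟩ <;> rw [e] <;>
      linarith [hξ.1]
  · linarith

/-- Because a vehicle may always do nothing, its truncated intervention lies between `0` and `x`. -/
theorem Improves.attained (h : Improves t₀ F x L) (h₀ : (0 : ℝ) ∈ Set.Icc (q - Q) q) {u : ℝ}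
    (hu : u ∈ Set.uIcc t₀ (t₀ + (x - max (q - Q) (min x q)))) :
    u + max (q - Q) (min x q) ∈ Set.uIcc t₀ (t₀ + x) ∧
      F (u + max (q - Q) (min x q)) = L + shortfall (x - max (q - Q) (min x q)) (u - t₀) := by
  obtain ⟨h₁, h₂⟩ := h₀
  generalize hX : max (q - Q) (min x q) = X at *
  rcases lt_trichotomy x X with hx | hx | hx
  · have hX0 : X ≤ 0 := by
      rw [← hX] at hx ⊢
      refine max_le h₁ ?_
      by_contra hc
      have := lt_min_iff.1 (not_le.1 hc)
      rw [max_eq_right (le_min (by linarith) (by linarith))] at hx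
      linarith [min_le_left x q]
    rw [Set.uIcc_of_ge (by linarith)] at hu
    have hm : u + X ∈ Set.uIcc t₀ (t₀ + x) := by
      rw [Set.uIcc_of_ge (by linarith)]
      exact ⟨by linarith [hu.1], by linarith [hu.2]⟩
    refine ⟨hm, ?_⟩
    rw [h.eq _ hm, shortfall, if_neg (by linarith), if_pos (by linarith), abs_of_nonpos,
      max_eq_right] <;> linarith [hu.1]
  · rw [hx, sub_self, add_zero, Set.uIcc_self] at hu
    rw [Set.mem_singleton_iff.1 hu, hx]
    have hm := Set.right_mem_uIcc (a := t₀) (b := t₀ + X)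
    refine ⟨hm, ?_⟩
    have := h.eq (t₀ + X) (hx ▸ hm)
    rw [this, hx, sub_self, sub_self, shortfall_zero, abs_zero]
  · have hX0 : 0 ≤ X := by
      rw [← hX]
      refine le_max_of_le_right (le_min ?_ h₂)
      by_contra hc
      rw [min_eq_left (by linarith)] at hX
      linarith [le_max_right (q - Q) x]
    rw [Set.uIcc_of_le (by linarith)] at hu
    have hm : u + X ∈ Set.uIcc t₀ (t₀ + x) := by
      rw [Set.uIcc_of_le (by linarith)]
      exact ⟨by linarith [hu.1], by linarith [hu.2]⟩
    refine ⟨hm, ?_⟩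
    rw [h.eq _ hm, shortfall, if_pos (by linarith), abs_of_nonneg,
      max_eq_right] <;> linarith [hu.2]

end Capacity

/-! ### Running programs on the machine -/

theorem RAM.bind_apply {α β : Type} (p : RAM α) (f : α → RAM β) (σ : Store) :
    (p >>= f) σ = ⟨(f (p σ).val (p σ).mem).val, (f (p σ).val (p σ).mem).mem,
      (p σ).cost + (f (p σ).val (p σ).mem).cost⟩ := rfl

theorem RAM.pure_apply {α : Type} (a : α) (σ : Store) : (pure a : RAM α) σ = ⟨a, σ, 0⟩ := rfl

theorem RAM.op_apply {α : Type} (a : α) (σ : Store) : op a σ = ⟨a, σ, 1⟩ := rfl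

/-- Unlike the general rule for `>>=`, this one substitutes `a` in the rest of the program, also in
the decidability instances of tests that depend on it. -/
theorem RAM.op_bind {α β : Type} (a : α) (f : α → RAM β) (σ : Store) :
    (op a >>= f) σ = ⟨(f a σ).val, (f a σ).mem, 1 + (f a σ).cost⟩ := rfl

theorem RAM.call_apply {α : Type} (p : RAM α) (σ : Store) :
    call p σ = ⟨(p σ).val, (p σ).mem, 1 + (p σ).cost⟩ := rfl

/-- The last round of a loop, split off. -/
theorem RAM.rounds_succ {α : Type} (body : ℕ → α → RAM α) (n h : ℕ) (a : α) (σ : Store) :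
    rounds body (n + 1) h a σ =
      let r := rounds body n h a σ
      let r' := body (h + n) r.val r.mem
      ⟨r'.val, r'.mem, r.cost + r'.cost + 2⟩ := by
  induction n generalizing h a σ with
  | zero => simp [rounds, RAM.bind_apply, RAM.pure_apply, tick, RAM.op_apply]; omega
  | succ n ih =>
    have unfold_first : ∀ k, rounds body (k + 1) h a σ =
        let r := body h a σ
        let r' := rounds body k (h + 1) r.val r.mem
        ⟨r'.val, r'.mem, 1 + (r.cost + (1 + r'.cost))⟩ := fun _ => rfl
    rw [unfold_first (n + 1), unfold_first n]
    dsimp only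
    rw [ih]
    simp only [Nat.add_right_comm h 1 n, Nat.add_assoc h n 1]
    congr 1
    omega

/-- The memory after the arrays for epoch `h` have been computed from the virtual stock `v`. -/
noncomputable def Store.setNull (σ : Store) (C : ℝ) (h : ℕ) (v : ℝ) : Store :=
  { σ with
    v := Function.update σ.v h v
    lp := Function.update σ.lp h (max 0 (v - C))
    lm := Function.update σ.lm h (max 0 (-v))
    s := Function.update σ.s h (clip C v) }

theorem nullStep_apply (C : ℝ) (h : ℕ) (σ : Store) :
    nullStep C h σ = ⟨(), σ.setNull C h (σ.s (h - 1) + σ.d h), 14⟩ := rfl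

/-- In the first round the trackers are infinite, so that both losses are avoided entirely. -/
theorem scanBody_first (C : ℝ) (h : ℕ) (σ : Store) :
    scanBody C h ⟨0, 0, ⊤, ⊥⟩ σ =
      ⟨⟨-σ.lp h + σ.lm h, 0, (σ.s h : ℝ), (σ.s h : ℝ)⟩, σ, 16⟩ := by
  have : ((C : EReal) - ⊥) = ⊤ := EReal.coe_sub_bot C
  simp [scanBody, RAM.bind_apply, RAM.pure_apply, RAM.op_apply, readLp, readLm, readS, this]

theorem scanBody_real (C : ℝ) (h : ℕ) (x L α β : ℝ) (σ : Store) :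
    scanBody C h ⟨x, L, α, β⟩ σ =
      ⟨⟨x - min (σ.lp h) α + min (σ.lm h) (C - β),
        L + (σ.lp h - min (σ.lp h) α) + (σ.lm h - min (σ.lm h) (C - β)),
        (min (α - min (σ.lp h) α) (σ.s h) : ℝ),
        (max (β + min (σ.lm h) (C - β)) (σ.s h) : ℝ)⟩, σ, 16⟩ := by
  simp only [scanBody, RAM.bind_apply, RAM.pure_apply, RAM.op_apply, readLp, readLm, readS]
  have hmin : ∀ a b : ℝ, min (a : EReal) b = (min a b : ℝ) := fun a b =>
    (EReal.coe_strictMono.monotone.map_min).symm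
  have hmax : ∀ a b : ℝ, max (a : EReal) b = (max a b : ℝ) := fun a b =>
    (EReal.coe_strictMono.monotone.map_max).symm
  simp only [← EReal.coe_sub, hmin, EReal.toReal_coe, ← EReal.coe_add, hmax]

/-- The truncation of the scan's intervention to the capacity, with the resulting loss. -/
theorem vehicleIntervention_apply (C : ℝ) (lo hi : ℕ) {q Q : ℝ} (hQ : q - Q ≤ q) (σ : Store) :
    let a := forLoop lo hi ⟨0, 0, ⊤, ⊥⟩ (scanBody C) σ
    let r := vehicleIntervention C lo hi q Q σ
    r.val = ⟨max (q - Q) (min a.val.x q),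
        a.val.L + |a.val.x - max (q - Q) (min a.val.x q)|, a.val.x, a.val.L⟩ ∧
      r.mem = a.mem ∧ r.cost ≤ a.cost + 5 := by
  intro a r
  by_cases h₁ : a.val.x < q - Q
  · have hr : r = ⟨⟨q - Q, a.val.L + (q - Q) - a.val.x, a.val.x, a.val.L⟩, a.mem,
        a.cost + 4⟩ := by
      simp only [r, vehicleIntervention]
      rw [RAM.bind_apply]
      simp only [RAM.op_bind]
      rw [if_pos (decide_eq_true h₁)]
      rfl
    rw [hr, min_eq_left (by linarith), max_eq_left h₁.le, abs_of_nonpos (by linarith)]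
    refine ⟨?_, rfl, by dsimp only; omega⟩
    dsimp only
    congr 1; ring
  by_cases h₂ : q < a.val.x
  · have hr : r = ⟨⟨q, a.val.L + a.val.x - q, a.val.x, a.val.L⟩, a.mem, a.cost + 5⟩ := by
      simp only [r, vehicleIntervention]
      rw [RAM.bind_apply]
      simp only [RAM.op_bind]
      rw [if_neg (by simpa using h₁)]
      simp only [RAM.op_bind]
      rw [if_pos (decide_eq_true h₂)]
      rfl
    rw [hr, min_eq_right h₂.le, max_eq_right hQ, abs_of_nonneg (by linarith)]
    refine ⟨?_, rfl, le_rfl⟩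
    dsimp only
    congr 1; ring
  · have hr : r = ⟨⟨a.val.x, a.val.L, a.val.x, a.val.L⟩, a.mem, a.cost + 3⟩ := by
      simp only [r, vehicleIntervention]
      rw [RAM.bind_apply]
      simp only [RAM.op_bind]
      rw [if_neg (by simpa using h₁)]
      simp only [RAM.op_bind]
      rw [if_neg (by simpa using h₂)]
      rfl
    rw [hr, min_eq_left (by linarith), max_eq_right (by linarith)]
    exact ⟨by simp, rfl, by dsimp only; omega⟩

/-! ### The dynamics between two visits -/

namespace Problem
variable (P : Problem)

/-- The stock after the `n` epochs from `lo` on, if there is no visit after `lo` and if `t` is the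
stock before `lo` plus the intervention at `lo`. -/
noncomputable def flow (lo : ℕ) : ℕ → ℝ → ℝ
  | 0, t => t
  | n + 1, t => clip P.C (flow lo n t + P.d (lo + n))

/-- The loss that accompanies `flow`. -/
noncomputable def flowLoss (lo : ℕ) : ℕ → ℝ → ℝ
  | 0, _ => 0
  | n + 1, t => flowLoss lo n t + clipLoss P.C (P.flow lo n t + P.d (lo + n))

/-- The visit epochs, completed by `m + 1` in place of a visit of vehicle `w + 1`. -/
def epoch (i : ℕ) : ℕ := if i ≤ P.w then P.e i else P.m + 1

theorem C_nonneg : 0 ≤ P.C := P.s₀_mem.1.trans P.s₀_mem.2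

theorem flow_mono (lo n : ℕ) : Monotone (P.flow lo n) := by
  induction n with
  | zero => exact monotone_id
  | succ n ih => exact fun t t' h => clip_mono P.C_nonneg (by gcongr; exact ih h)

theorem flow_mem (lo n : ℕ) (t : ℝ) : P.flow lo (n + 1) t ∈ Set.Icc 0 P.C :=
  clip_mem P.C_nonneg _

theorem stock_succ (x : ℕ → ℝ) (h : ℕ) :
    P.stock x (h + 1) = clip P.C (P.virtualStock x (h + 1)) := rfl

theorem epoch_of_le {i : ℕ} (hi : i ≤ P.w) : P.epoch i = P.e i := if_pos hi

theorem epoch_last : P.epoch (P.w + 1) = P.m + 1 := if_neg (by omega)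

theorem one_le_epoch {i : ℕ} (h₁ : 1 ≤ i) : 1 ≤ P.epoch i := by
  unfold epoch
  split_ifs with h
  · exact (Finset.mem_Icc.1 (P.e_mem i (Finset.mem_Icc.2 ⟨h₁, h⟩))).1
  · omega

theorem epoch_lt_succ {i : ℕ} (h₁ : 1 ≤ i) (h : i ≤ P.w) : P.epoch i < P.epoch (i + 1) := by
  rw [P.epoch_of_le h]
  unfold epoch
  split_ifs with h'
  · exact P.e_lt i h₁ h'
  · have := (Finset.mem_Icc.1 (P.e_mem i (Finset.mem_Icc.2 ⟨h₁, h⟩))).2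
    omega

theorem epoch_lt {i j : ℕ} (h₁ : 1 ≤ i) (hij : i < j) (hj : j ≤ P.w + 1) :
    P.epoch i < P.epoch j := by
  induction j, hij using Nat.le_induction with
  | base => exact P.epoch_lt_succ h₁ (by omega)
  | succ j hij ih =>
    exact (ih (by omega)).trans (P.epoch_lt_succ (by omega) (by omega))

theorem epoch_le {i j : ℕ} (h₁ : 1 ≤ i) (hij : i ≤ j) (hj : j ≤ P.w + 1) :
    P.epoch i ≤ P.epoch j := by
  rcases hij.eq_or_lt with rfl | h
  · exact le_rfl
  · exact (P.epoch_lt h₁ h hj).le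

theorem lastEpoch_eq {i : ℕ} (hi : i ≤ P.w) : P.lastEpoch i = P.epoch (i + 1) - 1 := by
  unfold lastEpoch epoch
  split_ifs <;> omega

theorem interventionAt_epoch {i : ℕ} (h₁ : 1 ≤ i) (hi : i ≤ P.w) (x : ℕ → ℝ) :
    P.interventionAt x (P.epoch i) = x i := by
  unfold interventionAt
  rw [Finset.sum_eq_single i]
  · intro j hj hji
    rw [Finset.mem_filter, Finset.mem_Icc] at hj
    obtain ⟨⟨hj₁, hjw⟩, he⟩ := hj
    rw [← P.epoch_of_le hjw] at he
    rcases lt_or_gt_of_ne hji with h | h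
    · exact absurd he (P.epoch_lt hj₁ h (by omega)).ne
    · exact absurd he (P.epoch_lt h₁ h (by omega)).ne'
  · intro h
    exact absurd (by simp [h₁, hi, P.epoch_of_le hi]) h

theorem interventionAt_eq_zero {i h : ℕ} (h₁ : 1 ≤ i) (hi : i ≤ P.w) (hl : P.epoch i < h)
    (hr : h < P.epoch (i + 1)) (x : ℕ → ℝ) : P.interventionAt x h = 0 := by
  unfold interventionAt
  refine Finset.sum_eq_zero fun j hj => ?_
  rw [Finset.mem_filter, Finset.mem_Icc] at hj
  obtain ⟨⟨hj₁, hjw⟩, he⟩ := hj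
  rw [← P.epoch_of_le hjw] at he
  rcases le_or_gt j i with h | h
  · have := P.epoch_le hj₁ h (by omega)
    omega
  · have := P.epoch_le (by omega : 1 ≤ i + 1) h (by omega)
    omega

theorem interventionAt_null (h : ℕ) : P.interventionAt (fun _ => 0) h = 0 := by
  simp [interventionAt]

theorem lossOn_succ {a b : ℕ} (hab : a ≤ b + 1) (x : ℕ → ℝ) :
    P.lossOn a (b + 1) x = P.lossOn a b x + clipLoss P.C (P.virtualStock x (b + 1)) := by
  unfold lossOn
  rw [Finset.sum_Icc_succ_top hab]
  rfl

theorem lossOn_split {a b c : ℕ} (hab : a ≤ b) (hbc : b ≤ c + 1) (hb : 1 ≤ b) (x : ℕ → ℝ) :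
    P.lossOn a c x = P.lossOn a (b - 1) x + P.lossOn b c x := by
  unfold lossOn
  have h : ∀ u v, Finset.Icc u v = Finset.Ico u (v + 1) := fun u v => by
    ext; simp
  rw [h, h, h, Nat.sub_add_cancel hb, Finset.sum_Ico_consecutive _ hab hbc]

/-- Interventions from vehicle `i` on do not affect what happens before its visit. -/
theorem interventionAt_congr {i h : ℕ} (h₁ : 1 ≤ i) (hh : h < P.epoch i)
    {x y : ℕ → ℝ} (hxy : ∀ j, 1 ≤ j → j < i → x j = y j) :
    P.interventionAt x h = P.interventionAt y h := by
  unfold interventionAt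
  refine Finset.sum_congr rfl fun j hj => ?_
  rw [Finset.mem_filter, Finset.mem_Icc] at hj
  obtain ⟨⟨hj₁, hjw⟩, he⟩ := hj
  rw [← P.epoch_of_le hjw] at he
  refine hxy j hj₁ ?_
  by_contra hc
  have := P.epoch_le h₁ (not_lt.1 hc) (by omega)
  omega

theorem stock_congr {i h : ℕ} (h₁ : 1 ≤ i) (hh : h < P.epoch i)
    {x y : ℕ → ℝ} (hxy : ∀ j, 1 ≤ j → j < i → x j = y j) : P.stock x h = P.stock y h := by
  induction h with
  | zero => rfl
  | succ h ih =>
    rw [stock_succ, stock_succ, virtualStock, virtualStock, Nat.add_sub_cancel, ih (by omega),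
      P.interventionAt_congr h₁ hh hxy]

theorem lossOn_congr {i a b : ℕ} (h₁ : 1 ≤ i) (hb : b < P.epoch i)
    {x y : ℕ → ℝ} (hxy : ∀ j, 1 ≤ j → j < i → x j = y j) : P.lossOn a b x = P.lossOn a b y := by
  unfold lossOn
  refine Finset.sum_congr rfl fun h hh => ?_
  have hh' := (Finset.mem_Icc.1 hh).2
  unfold surplusLoss stockoutLoss virtualStock
  rw [P.interventionAt_congr h₁ (by omega) hxy, P.stock_congr h₁ (by omega) hxy]

/-- Between two visits, stock and loss depend only on the amount after the first one. -/
theorem stock_eq_flow {i : ℕ} (h₁ : 1 ≤ i) (hi : i ≤ P.w) (x : ℕ → ℝ) (n : ℕ)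
    (hn : P.epoch i + n < P.epoch (i + 1)) :
    P.stock x (P.epoch i + n) =
        P.flow (P.epoch i) (n + 1) (P.stock x (P.epoch i - 1) + x i) ∧
      P.lossOn (P.epoch i) (P.epoch i + n) x =
        P.flowLoss (P.epoch i) (n + 1) (P.stock x (P.epoch i - 1) + x i) := by
  have hE := P.one_le_epoch h₁
  induction n with
  | zero =>
    obtain ⟨k, hk⟩ := Nat.exists_eq_add_of_le' hE
    have hv : P.virtualStock x (P.epoch i) =
        P.stock x (P.epoch i - 1) + x i + P.d (P.epoch i) := by
      rw [virtualStock, P.interventionAt_epoch h₁ hi]; ring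
    constructor
    · rw [add_zero, flow, flow, add_zero, ← hv, hk, stock_succ]
    · rw [add_zero, lossOn, Finset.Icc_self, Finset.sum_singleton, flowLoss, flowLoss, flow,
        add_zero, zero_add, ← hv]
      rfl
  | succ n ih =>
    obtain ⟨ih₁, ih₂⟩ := ih (by omega)
    have hv : P.virtualStock x (P.epoch i + n + 1) =
        P.flow (P.epoch i) (n + 1) (P.stock x (P.epoch i - 1) + x i)
          + P.d (P.epoch i + (n + 1)) := by
      rw [virtualStock, P.interventionAt_eq_zero h₁ hi (by omega) (by omega), Nat.add_sub_cancel,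
        ih₁, add_zero, add_assoc]
    constructor
    · rw [← add_assoc, stock_succ, hv, ← flow]
    · rw [← add_assoc, P.lossOn_succ (by omega), ih₂, hv, ← flowLoss]

end Problem

/-! ### One stage of the recursion -/

/-- The stock of the null vector. -/
noncomputable def Problem.nullStock (P : Problem) (h : ℕ) : ℝ := P.stock (fun _ => 0) h

/-- The arrays contain the stock and the losses of the null vector at epoch `h`. -/
structure Store.NullAt (σ : Store) (P : Problem) (h : ℕ) : Prop where
  s : σ.s h = P.nullStock h
  lp : σ.lp h = max 0 (P.nullStock (h - 1) + P.d h - P.C)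
  lm : σ.lm h = max 0 (-(P.nullStock (h - 1) + P.d h))

/-- All data lie in the subgroup `G` of `ℝ`. Integrality is the case of the subgroup of integers;
the algorithm preserves any subgroup, as it only adds, subtracts and takes minima and maxima. -/
structure Problem.DataIn (P : Problem) (G : AddSubgroup ℝ) : Prop where
  C : P.C ∈ G
  s₀ : P.s₀ ∈ G
  d : ∀ h, 1 ≤ h → h ≤ P.m → P.d h ∈ G
  q : ∀ i, 1 ≤ i → i ≤ P.w → P.q i ∈ G
  Q : ∀ i, 1 ≤ i → i ≤ P.w → P.Q i ∈ G

theorem max_mem_subgroup {G : AddSubgroup ℝ} {a b : ℝ} (ha : a ∈ G) (hb : b ∈ G) :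
    max a b ∈ G := by
  rcases max_choice a b with h | h <;> rwa [h]

theorem min_mem_subgroup {G : AddSubgroup ℝ} {a b : ℝ} (ha : a ∈ G) (hb : b ∈ G) :
    min a b ∈ G := by
  rcases min_choice a b with h | h <;> rwa [h]

namespace Problem
variable {P : Problem}

theorem nullStock_succ (h : ℕ) :
    P.nullStock (h + 1) = clip P.C (P.nullStock h + P.d (h + 1)) := by
  rw [nullStock, stock_succ, virtualStock, interventionAt_null, add_zero]
  rfl

theorem DataIn.nullStock_mem {G : AddSubgroup ℝ} (hG : P.DataIn G) {h : ℕ} (hh : h ≤ P.m) :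
    P.nullStock h ∈ G := by
  induction h with
  | zero => exact hG.s₀
  | succ h ih =>
    have hv := G.add_mem (ih (by omega)) (hG.d (h + 1) (by omega) hh)
    rw [nullStock_succ, clip]
    exact G.add_mem (G.sub_mem hv (max_mem_subgroup G.zero_mem (G.sub_mem hv hG.C)))
      (max_mem_subgroup G.zero_mem (G.neg_mem hv))

/-- The scan of a part of the null trajectory. -/
theorem scan_tracks {σ : Store} {lo : ℕ} (hlo : 1 ≤ lo) (n : ℕ)
    (hσ : ∀ h, lo ≤ h → h ≤ lo + n → σ.NullAt P h) :
    ∃ x L α β : ℝ, rounds (scanBody P.C) (n + 1) lo ⟨0, 0, ⊤, ⊥⟩ σ =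
        ⟨⟨x, L, (α : EReal), (β : EReal)⟩, σ, 18 * (n + 1) + 1⟩ ∧
      Tracks P.C (P.nullStock (lo - 1)) (P.flow lo (n + 1)) (P.flowLoss lo (n + 1))
        (P.nullStock (lo + n)) x L α β ∧
      ∀ G : AddSubgroup ℝ, P.DataIn G → lo + n ≤ P.m → x ∈ G ∧ α ∈ G ∧ β ∈ G := by
  induction n with
  | zero =>
    have hlo' := hσ lo le_rfl le_rfl
    obtain ⟨k, rfl⟩ := Nat.exists_eq_add_of_le' hlo
    refine ⟨-σ.lp (k + 1) + σ.lm (k + 1), 0, σ.s (k + 1), σ.s (k + 1), ?_, ?_,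
      fun G hG hm => ?_⟩
    · rw [RAM.rounds_succ]
      simp only [rounds, RAM.bind_apply, tick, RAM.op_apply, RAM.pure_apply, add_zero,
        scanBody_first]
    · rw [hlo'.lp, hlo'.lm, hlo'.s]
      have h := Tracks.first P.C_nonneg (P.nullStock k) (P.d (k + 1))
      rw [← nullStock_succ] at h
      have hF : P.flowLoss (k + 1) (0 + 1) = fun t => clipLoss P.C (t + P.d (k + 1)) := by
        funext t; simp [flowLoss, flow]
      rw [hF]
      exact h
    · have hs := hG.nullStock_mem (h := k) (by omega)
      have hv := G.add_mem hs (hG.d (k + 1) (by omega) hm)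
      have hs' := hG.nullStock_mem (h := k + 1) (by omega)
      rw [hlo'.lp, hlo'.lm, hlo'.s]
      exact ⟨G.add_mem (G.neg_mem (max_mem_subgroup G.zero_mem (G.sub_mem hv hG.C)))
        (max_mem_subgroup G.zero_mem (G.neg_mem hv)), hs', hs'⟩
  | succ n ih =>
    obtain ⟨x, L, α, β, hr, ht, hG⟩ := ih fun h h₁ h₂ => hσ h h₁ (by omega)
    have hn := hσ (lo + (n + 1)) (by omega) le_rfl
    let k := lo + (n + 1)
    refine ⟨x - min (σ.lp k) α + min (σ.lm k) (P.C - β),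
      L + (σ.lp k - min (σ.lp k) α) + (σ.lm k - min (σ.lm k) (P.C - β)),
      min (α - min (σ.lp k) α) (σ.s k), max (β + min (σ.lm k) (P.C - β)) (σ.s k),
      ?_, ?_, fun G hd hm => ?_⟩
    · rw [RAM.rounds_succ, hr]
      simp only [scanBody_real]
      congr 1
    · have h := ht.step P.C_nonneg (P.d (lo + (n + 1))) hn.lp hn.lm
      rw [← add_assoc, ← nullStock_succ, add_assoc, ← hn.s] at h
      rw [← hn.s]
      exact h
    · obtain ⟨hx, hα, hβ⟩ := hG G hd (by omega)
      have hs := hd.nullStock_mem (h := lo + n) (by omega)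
      have hv := G.add_mem hs (hd.d (lo + (n + 1)) (by omega) hm)
      have hs' := hd.nullStock_mem hm
      have hlp := max_mem_subgroup G.zero_mem (G.sub_mem hv hd.C)
      have hlm := max_mem_subgroup G.zero_mem (G.neg_mem hv)
      rw [hn.lp, hn.lm, hn.s]
      have hδp := min_mem_subgroup hlp hα
      have hδm := min_mem_subgroup hlm (G.sub_mem hd.C hβ)
      exact ⟨G.add_mem (G.sub_mem hx hδp) hδm, min_mem_subgroup (G.sub_mem hα hδp) hs',
        max_mem_subgroup (G.add_mem hβ hδm) hs'⟩

end Problem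

theorem augment_zero (C : ℝ) (hi : ℕ) (σ : Store) : augment C hi 0 σ = ⟨hi - 1, σ, 3⟩ := by
  simp only [augment, RAM.op_bind]
  rw [if_neg (by simp)]
  simp only [RAM.op_bind]
  rw [if_neg (by simp)]
  rfl

/-- The memory after the demand at epoch `h` has been replaced by `d`. -/
noncomputable def Store.augmented (σ : Store) (C : ℝ) (h : ℕ) (d : ℝ) : Store :=
  { σ with d := Function.update σ.d h d }.setNull C h (σ.s (h - 1) + d)

theorem augment_pos {C δ : ℝ} (hi : ℕ) (hδ : 0 < δ) (σ : Store) :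
    augment C hi δ σ = ⟨hi, σ.augmented C hi (-σ.s (hi - 1) - |δ|), 22⟩ := by
  simp only [augment, RAM.op_bind]
  rw [if_pos (by simpa using hδ)]
  simp only [RAM.bind_apply, RAM.op_apply, readS, writeD, RAM.call_apply, nullStep_apply,
    RAM.pure_apply, Function.update_self, Store.augmented]

theorem augment_neg {C δ : ℝ} (hi : ℕ) (hδ : δ < 0) (σ : Store) :
    augment C hi δ σ = ⟨hi, σ.augmented C hi (C - σ.s (hi - 1) + |δ|), 23⟩ := by
  simp only [augment, RAM.op_bind]
  rw [if_neg (by simpa using hδ.le)]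
  simp only [RAM.op_bind]
  rw [if_pos (by simpa using hδ)]
  simp only [RAM.bind_apply, RAM.op_apply, readS, writeD, RAM.call_apply, nullStep_apply,
    RAM.pure_apply, Function.update_self, Store.augmented]

/-- `σ'` has the visit epochs and the vehicle data of `σ`, and its losses and stock levels before
epoch `h`. The demands are left open: once the null trajectory is known, only augmented ones are
read. -/
structure Store.AgreesBefore (σ σ' : Store) (h : ℕ) : Prop where
  H : σ'.H = σ.H
  q : σ'.q = σ.q
  Q : σ'.Q = σ.Q
  lp : ∀ k < h, σ'.lp k = σ.lp k
  lm : ∀ k < h, σ'.lm k = σ.lm k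
  s : ∀ k < h, σ'.s k = σ.s k

theorem Store.agreesBefore_augmented (σ : Store) (C : ℝ) (h : ℕ) (d : ℝ) :
    σ.AgreesBefore (σ.augmented C h d) h :=
  ⟨rfl, rfl, rfl, fun _ hk => Function.update_of_ne hk.ne _ _,
    fun _ hk => Function.update_of_ne hk.ne _ _, fun _ hk => Function.update_of_ne hk.ne _ _⟩

theorem Store.AgreesBefore.nullAt {σ σ' : Store} {h k : ℕ} {P : Problem}
    (hσ : σ.AgreesBefore σ' h) (hk : k < h) (hn : σ.NullAt P k) : σ'.NullAt P k :=
  ⟨(hσ.s k hk).trans hn.s, (hσ.lp k hk).trans hn.lp, (hσ.lm k hk).trans hn.lm⟩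

namespace Problem
variable {P : Problem}

/-- Augmentation and scan at a stage compute the best change `x` of the stock before the visit,
for the loss until the next visit together with the shortfall against the request `δ`. -/
theorem stage_scan {σ : Store} {lo top : ℕ} (hlo : 1 ≤ lo) (hlt : lo < top)
    (hσ : ∀ h, lo ≤ h → h < top → σ.NullAt P h) (δ : ℝ) :
    ∃ (σ' : Store) (hi : ℕ) (a : Scan) (c₁ c₂ : ℕ), augment P.C top δ σ = ⟨hi, σ', c₁⟩ ∧
      forLoop lo hi ⟨0, 0, ⊤, ⊥⟩ (scanBody P.C) σ' = ⟨a, σ', c₂⟩ ∧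
      c₁ + c₂ ≤ 18 * (top - lo) + 50 ∧ σ.AgreesBefore σ' top ∧
      Improves (P.nullStock (lo - 1)) (fun t => P.flowLoss lo (top - lo) t +
        shortfall δ (P.flow lo (top - lo) t - P.nullStock (top - 1))) a.x a.L ∧
      (∀ t ∈ Set.uIcc (P.nullStock (lo - 1)) (P.nullStock (lo - 1) + a.x),
        P.flow lo (top - lo) t ∈
          Set.uIcc (P.nullStock (top - 1)) (P.nullStock (top - 1) + δ)) ∧
      ∀ G : AddSubgroup ℝ, P.DataIn G → top ≤ P.m + 1 → δ ∈ G → a.x ∈ G := by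
  obtain ⟨n, rfl⟩ := Nat.exists_eq_add_of_lt hlt
  have hs : σ.s (lo + n) = P.nullStock (lo + n) := (hσ (lo + n) (by omega) (by omega)).s
  have e₁ : lo + n + 1 - lo = n + 1 := by omega
  have e₂ : lo + n + 1 - 1 = lo + n := rfl
  have e₃ : lo + n + 1 + 1 - lo = n + 1 + 1 := by omega
  have hmono := P.flow_mono lo (n + 1)
  have hmem := P.flow_mem lo n
  simp only [forLoop, e₁, e₂]
  rcases lt_trichotomy δ 0 with hδ | rfl | hδ
  · have hag := σ.agreesBefore_augmented P.C (lo + n + 1) (P.C - σ.s (lo + n) + |δ|)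
    have hv : σ.s (lo + n) + (P.C - σ.s (lo + n) + |δ|) = P.C - δ := by
      rw [abs_of_neg hδ]; ring
    obtain ⟨x, L, α, β, hr, ht, hG⟩ := scan_tracks (P := P)
      (σ := σ.augmented P.C (lo + n + 1) (P.C - σ.s (lo + n) + |δ|)) hlo n
      fun h h₁ h₂ => hag.nullAt (by omega) (hσ h h₁ (by omega))
    obtain ⟨hi, hst⟩ := ht.augment_neg hmono hmem hδ
    have hlp : (σ.augmented P.C (lo + n + 1) (P.C - σ.s (lo + n) + |δ|)).lp (lo + n + 1) = -δ := by
      simp only [Store.augmented, Store.setNull, Function.update_self, e₂, hv]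
      rw [max_eq_right] <;> linarith
    have hlm : (σ.augmented P.C (lo + n + 1) (P.C - σ.s (lo + n) + |δ|)).lm (lo + n + 1) = 0 := by
      simp only [Store.augmented, Store.setNull, Function.update_self, e₂, hv]
      rw [max_eq_left]; linarith [P.C_nonneg]
    -- the scan of the augmented epoch, which sees a single loss `|δ|`
    obtain ⟨A, B, hfin⟩ : ∃ A B : EReal, rounds (scanBody P.C) (n + 1 + 1) lo ⟨0, 0, ⊤, ⊥⟩
        (σ.augmented P.C (lo + n + 1) (P.C - σ.s (lo + n) + |δ|)) =
          ⟨⟨x - min (-δ) α, L + (-δ - min (-δ) α), A, B⟩,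
            σ.augmented P.C (lo + n + 1) (P.C - σ.s (lo + n) + |δ|), 18 * (n + 1) + 1 + 16 + 2⟩ := by
      rw [RAM.rounds_succ, hr]
      simp only [← add_assoc, scanBody_real, hlp, hlm, min_eq_left (sub_nonneg.2 ht.β_le), add_zero, sub_zero]
      exact ⟨_, _, rfl⟩
    refine ⟨_, _, _, _, _, augment_neg _ hδ σ, by rw [e₃]; exact hfin, ?_, hag, ?_, ?_, ?_⟩
    · omega
    · exact hi
    · exact hst
    · intro G hd hm hδG
      obtain ⟨hx, hα, -⟩ := hG G hd (by omega)
      exact G.sub_mem hx (min_mem_subgroup (G.neg_mem hδG) hα)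
  · obtain ⟨x, L, α, β, hr, ht, hG⟩ := scan_tracks (P := P) (σ := σ) hlo n
      fun h h₁ h₂ => hσ h h₁ (by omega)
    refine ⟨_, _, _, _, _, augment_zero _ _ _, by rw [e₂, e₁]; exact hr, ?_,
      ⟨rfl, rfl, rfl, fun _ _ => rfl, fun _ _ => rfl, fun _ _ => rfl⟩, ?_, ?_, ?_⟩
    · omega
    · simpa only [shortfall_zero, add_zero] using ht.improves
    · intro t hx
      rw [ht.stock_eq hmono hx]
      exact Set.left_mem_uIcc
    · exact fun G hd hm _ => (hG G hd (by omega)).1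
  · have hag := σ.agreesBefore_augmented P.C (lo + n + 1) (-σ.s (lo + n) - |δ|)
    have hv : σ.s (lo + n) + (-σ.s (lo + n) - |δ|) = -δ := by
      rw [abs_of_pos hδ]; ring
    obtain ⟨x, L, α, β, hr, ht, hG⟩ := scan_tracks (P := P)
      (σ := σ.augmented P.C (lo + n + 1) (-σ.s (lo + n) - |δ|)) hlo n
      fun h h₁ h₂ => hag.nullAt (by omega) (hσ h h₁ (by omega))
    obtain ⟨hi, hst⟩ := ht.augment_pos hmono hmem hδ
    have hlp : (σ.augmented P.C (lo + n + 1) (-σ.s (lo + n) - |δ|)).lp (lo + n + 1) = 0 := by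
      simp only [Store.augmented, Store.setNull, Function.update_self, e₂, hv]
      rw [max_eq_left]; linarith [P.C_nonneg]
    have hlm : (σ.augmented P.C (lo + n + 1) (-σ.s (lo + n) - |δ|)).lm (lo + n + 1) = δ := by
      simp only [Store.augmented, Store.setNull, Function.update_self, e₂, hv]
      rw [max_eq_right] <;> linarith
    -- the scan of the augmented epoch, which sees a single loss `|δ|`
    obtain ⟨A, B, hfin⟩ : ∃ A B : EReal, rounds (scanBody P.C) (n + 1 + 1) lo ⟨0, 0, ⊤, ⊥⟩
        (σ.augmented P.C (lo + n + 1) (-σ.s (lo + n) - |δ|)) =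
          ⟨⟨x + min δ (P.C - β), L + (δ - min δ (P.C - β)), A, B⟩,
            σ.augmented P.C (lo + n + 1) (-σ.s (lo + n) - |δ|), 18 * (n + 1) + 1 + 16 + 2⟩ := by
      rw [RAM.rounds_succ, hr]
      simp only [← add_assoc, scanBody_real, hlp, hlm, min_eq_left ht.α_nonneg, add_zero, sub_zero]
      exact ⟨_, _, rfl⟩
    refine ⟨_, _, _, _, _, augment_pos _ hδ σ, by rw [e₃]; exact hfin, ?_, hag, ?_, ?_, ?_⟩
    · omega
    · exact hi
    · exact hst
    · intro G hd hm hδG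
      obtain ⟨hx, -, hβ⟩ := hG G hd (by omega)
      exact G.add_mem hx (min_mem_subgroup hδG (G.sub_mem hd.C hβ))

end Problem

/-! ### The recursion -/

namespace Problem
variable {P : Problem}

/-- The objective of the recursion at stage `i` with request `δ`: the loss of the interventions `y`
on `J i` and the shortfall of the stock after `J i`. -/
noncomputable def stageCost (P : Problem) (i : ℕ) (δ : ℝ) (y : ℕ → ℝ) : ℝ :=
  P.lossOn (P.epoch 1) (P.epoch (i + 1) - 1) y +
    shortfall δ (P.stock y (P.epoch (i + 1) - 1) - P.nullStock (P.epoch (i + 1) - 1))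

/-- The first `i` interventions of `x` minimize the objective of stage `i`, with minimum `L`. They
do not overshoot the request `δ`, and they lie in every subgroup that contains the data and `δ`. -/
structure SolvesStage (P : Problem) (i : ℕ) (δ : ℝ) (x : ℕ → ℝ) (L : ℝ) : Prop where
  admissible : ∀ j, 1 ≤ j → j ≤ i → P.Admissible j (x j)
  eq : L = P.stageCost i δ x
  le : ∀ y, (∀ j, 1 ≤ j → j ≤ i → P.Admissible j (y j)) → L ≤ P.stageCost i δ y
  stock : P.stock x (P.epoch (i + 1) - 1) ∈
    Set.uIcc (P.nullStock (P.epoch (i + 1) - 1)) (P.nullStock (P.epoch (i + 1) - 1) + δ)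
  mem : ∀ G : AddSubgroup ℝ, P.DataIn G → δ ∈ G → ∀ j, 1 ≤ j → j ≤ i → x j ∈ G

theorem zero_mem_admissible {i : ℕ} (h₁ : 1 ≤ i) (hi : i ≤ P.w) :
    (0 : ℝ) ∈ Set.Icc (P.q i - P.Q i) (P.q i) := by
  have := P.q_mem i (Finset.mem_Icc.2 ⟨h₁, hi⟩)
  exact ⟨by linarith [this.2], this.1⟩

/-- Before the first visit there is nothing to decide, and all of the request is missing. -/
theorem stageCost_zero (δ : ℝ) (y : ℕ → ℝ) : P.stageCost 0 δ y = |δ| := by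
  have h := P.one_le_epoch le_rfl
  have hs : P.stock y (P.epoch 1 - 1) = P.nullStock (P.epoch 1 - 1) :=
    P.stock_congr le_rfl (by omega) (fun j _ _ => by omega)
  rw [stageCost, zero_add, hs, sub_self, shortfall_at_zero, lossOn, Finset.Icc_eq_empty (by omega),
    Finset.sum_empty, zero_add]

theorem solvesStage_zero (δ : ℝ) (x : ℕ → ℝ) : P.SolvesStage 0 δ x |δ| where
  admissible := fun j _ _ => by omega
  eq := (stageCost_zero δ x).symm
  le := fun y _ => (stageCost_zero δ y).ge
  stock := by
    have h := P.one_le_epoch le_rfl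
    have hs : P.stock x (P.epoch 1 - 1) = P.nullStock (P.epoch 1 - 1) :=
      P.stock_congr le_rfl (by omega) (fun j _ _ => by omega)
    rw [zero_add, hs]
    exact Set.left_mem_uIcc
  mem := fun _ _ _ j _ _ => by omega

theorem stock_visit_end {i : ℕ} (h₁ : 1 ≤ i) (hi : i ≤ P.w) (y : ℕ → ℝ) :
    P.stock y (P.epoch (i + 1) - 1) = P.flow (P.epoch i) (P.epoch (i + 1) - P.epoch i)
        (P.stock y (P.epoch i - 1) + y i) ∧
      P.lossOn (P.epoch i) (P.epoch (i + 1) - 1) y =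
        P.flowLoss (P.epoch i) (P.epoch (i + 1) - P.epoch i)
          (P.stock y (P.epoch i - 1) + y i) := by
  obtain ⟨n, hn⟩ := Nat.exists_eq_add_of_lt (P.epoch_lt_succ h₁ hi)
  rw [hn, Nat.add_sub_cancel, show P.epoch i + n + 1 - P.epoch i = n + 1 by omega]
  exact P.stock_eq_flow h₁ hi y n (by omega)

theorem stageCost_succ {i : ℕ} (hi : i + 1 ≤ P.w) (δ : ℝ) (y : ℕ → ℝ) :
    P.stageCost (i + 1) δ y = P.lossOn (P.epoch 1) (P.epoch (i + 1) - 1) y +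
      (P.flowLoss (P.epoch (i + 1)) (P.epoch (i + 2) - P.epoch (i + 1))
          (P.stock y (P.epoch (i + 1) - 1) + y (i + 1)) +
        shortfall δ (P.flow (P.epoch (i + 1)) (P.epoch (i + 2) - P.epoch (i + 1))
          (P.stock y (P.epoch (i + 1) - 1) + y (i + 1)) - P.nullStock (P.epoch (i + 2) - 1))) := by
  have h₁ := P.epoch_le le_rfl (by omega : 1 ≤ i + 1) (by omega)
  have h₂ := P.epoch_lt_succ (by omega : 1 ≤ i + 1) hi
  have h₃ := P.one_le_epoch (by omega : 1 ≤ i + 1)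
  obtain ⟨hs, hl⟩ := stock_visit_end (by omega : 1 ≤ i + 1) hi y
  rw [stageCost, P.lossOn_split h₁ (by omega) h₃, hl, hs, add_assoc]

/-- A stage is solved by the truncated best change of the stock, if the earlier stages are asked
for the rest of that change. -/
theorem SolvesStage.succ {i : ℕ} (hi : i + 1 ≤ P.w) {δ ξ L L' : ℝ} {x : ℕ → ℝ}
    (hF : Improves (P.nullStock (P.epoch (i + 1) - 1))
      (fun t => P.flowLoss (P.epoch (i + 1)) (P.epoch (i + 2) - P.epoch (i + 1)) t +
        shortfall δ (P.flow (P.epoch (i + 1)) (P.epoch (i + 2) - P.epoch (i + 1)) t -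
          P.nullStock (P.epoch (i + 2) - 1))) ξ L)
    (hS : ∀ t ∈ Set.uIcc (P.nullStock (P.epoch (i + 1) - 1))
        (P.nullStock (P.epoch (i + 1) - 1) + ξ),
      P.flow (P.epoch (i + 1)) (P.epoch (i + 2) - P.epoch (i + 1)) t ∈
        Set.uIcc (P.nullStock (P.epoch (i + 2) - 1)) (P.nullStock (P.epoch (i + 2) - 1) + δ))
    (hG : ∀ G : AddSubgroup ℝ, P.DataIn G → δ ∈ G → ξ ∈ G)
    (h : P.SolvesStage i
      (ξ - max (P.q (i + 1) - P.Q (i + 1)) (min ξ (P.q (i + 1)))) x L') :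
    P.SolvesStage (i + 1) δ (Function.update x (i + 1)
      (max (P.q (i + 1) - P.Q (i + 1)) (min ξ (P.q (i + 1))))) (L + L') := by
  have h₀ := zero_mem_admissible (by omega : 1 ≤ i + 1) hi
  have h₁ := P.one_le_epoch (by omega : 1 ≤ i + 1)
  set X := max (P.q (i + 1) - P.Q (i + 1)) (min ξ (P.q (i + 1))) with hX
  set x' := Function.update x (i + 1) X with hx'
  have hne : ∀ j, j ≤ i → x' j = x j := fun j hj => Function.update_of_ne (by omega) _ _
  have hself : x' (i + 1) = X := Function.update_self _ _ _
  have hst : P.stock x' (P.epoch (i + 1) - 1) = P.stock x (P.epoch (i + 1) - 1) :=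
    P.stock_congr (by omega : 1 ≤ i + 1) (by omega) fun j _ hj => hne j (by omega)
  have hl : P.lossOn (P.epoch 1) (P.epoch (i + 1) - 1) x' =
      P.lossOn (P.epoch 1) (P.epoch (i + 1) - 1) x :=
    P.lossOn_congr (by omega : 1 ≤ i + 1) (by omega) fun j _ hj => hne j (by omega)
  obtain ⟨hu, hFu⟩ := hF.attained h₀ h.stock
  have hadm : X ∈ Set.Icc (P.q (i + 1) - P.Q (i + 1)) (P.q (i + 1)) :=
    ⟨le_max_left _ _, max_le (h₀.1.trans h₀.2) (min_le_right _ _)⟩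
  refine ⟨fun j hj₁ hj => ?_, ?_, fun y hy => ?_, ?_, fun G hd hδ j hj₁ hj => ?_⟩
  · rcases Nat.lt_or_ge j (i + 1) with hlt | hge
    · rw [hne j (by omega)]
      exact h.admissible j hj₁ (by omega)
    · obtain rfl : j = i + 1 := by omega
      rw [hself]
      exact hadm
  · rw [stageCost_succ hi, hst, hl, hself, h.eq, stageCost]
    simp only [← hX] at hFu
    linarith [hFu]
  · rw [stageCost_succ hi]
    have h₂ := hF.add_shortfall_le h₀ (P.stock y (P.epoch (i + 1) - 1))
      (hy (i + 1) (by omega) le_rfl)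
    have h₃ := h.le y fun j hj₁ hj => hy j hj₁ (by omega)
    rw [stageCost] at h₃
    simp only [← hX] at h₂
    linarith
  · rw [(stock_visit_end (by omega : 1 ≤ i + 1) hi x').1, hst, hself]
    exact hS _ hu
  · have hξ := hG G hd hδ
    have hq := hd.q (i + 1) (by omega) hi
    have hXG : X ∈ G := max_mem_subgroup (G.sub_mem hq (hd.Q (i + 1) (by omega) hi))
      (min_mem_subgroup hξ hq)
    rcases Nat.lt_or_ge j (i + 1) with hlt | hge
    · rw [hne j (by omega)]
      exact h.mem G hd (G.sub_mem hξ hXG) j hj₁ (by omega)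
    · obtain rfl : j = i + 1 := by omega
      rwa [hself]

end Problem

theorem RAM.bind_of_eq {α β : Type} {p : RAM α} {σ σ' : Store} {a : α} {c : ℕ}
    (h : p σ = ⟨a, σ', c⟩) (f : α → RAM β) :
    (p >>= f) σ = ⟨(f a σ').val, (f a σ').mem, c + (f a σ').cost⟩ := by
  rw [RAM.bind_apply, h]

/-- The memory holds what the recursion needs for the first `i` stages. -/
structure Store.Ready (σ : Store) (P : Problem) (i : ℕ) : Prop where
  H : ∀ j, 1 ≤ j → j ≤ i + 1 → σ.H j = P.epoch j
  q : ∀ j, 1 ≤ j → j ≤ i → σ.q j = P.q j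
  Q : ∀ j, 1 ≤ j → j ≤ i → σ.Q j = P.Q j
  null : ∀ h, P.epoch 1 ≤ h → h < P.epoch (i + 1) → σ.NullAt P h

theorem Store.Ready.pred {σ σ' : Store} {P : Problem} {i : ℕ} (h : σ.Ready P (i + 1))
    (hi : i + 1 ≤ P.w) (hσ : σ.AgreesBefore σ' (P.epoch (i + 2))) : σ'.Ready P i where
  H := fun j h₁ hj => by rw [hσ.H]; exact h.H j h₁ (by omega)
  q := fun j h₁ hj => by rw [hσ.q]; exact h.q j h₁ (by omega)
  Q := fun j h₁ hj => by rw [hσ.Q]; exact h.Q j h₁ (by omega)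
  null := fun k h₁ hk => by
    have hlt := hk.trans (P.epoch_lt_succ (by omega : 1 ≤ i + 1) hi)
    exact hσ.nullAt hlt (h.null k h₁ hlt)

/-- The recursion solves its stage, in time proportional to the length of `J i`: the scan of a
stage exceeds the interval of that stage by at most one epoch. A round of the scan takes `18` steps;
the factor `100` covers the constant overhead of a stage, whose interval is nonempty. -/
theorem globalBackwardRec_solves {P : Problem} (i : ℕ) (hi : i + 1 ≤ P.w) (δ : ℝ) (σ : Store)
    (hσ : σ.Ready P (i + 1)) :
    let r := globalBackwardRec P.C (i + 1) δ σ
    P.SolvesStage (i + 1) δ r.mem.x r.val ∧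
      r.cost ≤ 100 * (P.epoch (i + 2) - P.epoch 1) := by
  induction i generalizing δ σ with
  | zero =>
    have hlt : P.epoch 1 < P.epoch 2 := P.epoch_lt_succ le_rfl hi
    obtain ⟨σ', hi', a, c₁, c₂, haug, hscan, hc, hag, hF, hS, hG⟩ :=
      Problem.stage_scan (P.one_le_epoch le_rfl) hlt hσ.null δ
    have h₀ := Problem.zero_mem_admissible le_rfl hi
    obtain ⟨hv, hm, hvc⟩ := vehicleIntervention_apply P.C (P.epoch 1) hi' (h₀.1.trans h₀.2) σ'
    rw [hscan] at hv hm hvc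
    have htop : P.epoch 2 ≤ P.m + 1 :=
      (P.epoch_le (by omega) (by omega) le_rfl).trans P.epoch_last.le
    have hsol := (Problem.solvesStage_zero (a.x - max (P.q 1 - P.Q 1) (min a.x (P.q 1)))
      σ'.x).succ hi hF hS (fun G hd hδ => hG G hd htop hδ)
    obtain ⟨c, hr, hcost⟩ : ∃ c, globalBackwardRec P.C 1 δ σ =
        ⟨a.L + |a.x - max (P.q 1 - P.Q 1) (min a.x (P.q 1))|,
          { σ' with x := Function.update σ'.x 1 (max (P.q 1 - P.Q 1) (min a.x (P.q 1))) }, c⟩ ∧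
        c ≤ c₁ + c₂ + 20 := by
      rw [globalBackwardRec]
      have e₁ : readH (0 + 1) σ = ⟨P.epoch 1, σ, 1⟩ := by
        rw [← hσ.H 1 le_rfl (by omega)]; rfl
      have e₂ : readH (0 + 1 + 1) σ = ⟨P.epoch 2, σ, 1⟩ := by
        rw [← hσ.H 2 (by omega) le_rfl]; rfl
      have e₃ : readq (0 + 1) σ' = ⟨P.q 1, σ', 1⟩ := by
        rw [← hσ.q 1 le_rfl le_rfl, ← hag.q]; rfl
      have e₄ : readQ (0 + 1) σ' = ⟨P.Q 1, σ', 1⟩ := by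
        rw [← hσ.Q 1 le_rfl le_rfl, ← hag.Q]; rfl
      rw [RAM.bind_of_eq e₁, RAM.op_bind, RAM.bind_of_eq e₂, RAM.bind_of_eq haug,
        RAM.bind_of_eq e₃, RAM.bind_of_eq e₄, RAM.bind_apply, RAM.call_apply]
      dsimp only
      rw [hm, hv, RAM.op_bind, if_neg (by simp)]
      refine ⟨_, rfl, ?_⟩
      simp only [RAM.bind_apply, writeX, RAM.pure_apply]
      dsimp only at hvc
      omega
    intro r
    simp only [r]
    rw [zero_add, hr]
    refine ⟨hsol, ?_⟩
    change c ≤ 100 * (P.epoch 2 - P.epoch 1)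
    omega
  | succ i ih =>
    have hlt : P.epoch (i + 2) < P.epoch (i + 3) := P.epoch_lt_succ (by omega) hi
    have hle := P.epoch_le le_rfl (by omega : 1 ≤ i + 2) (by omega)
    obtain ⟨σ', hi', a, c₁, c₂, haug, hscan, hc, hag, hF, hS, hG⟩ :=
      Problem.stage_scan (P.one_le_epoch (by omega : 1 ≤ i + 2)) hlt
        (fun h h₁ h₂ => hσ.null h (by omega) h₂) δ
    have h₀ := Problem.zero_mem_admissible (by omega : 1 ≤ i + 2) hi
    obtain ⟨hv, hm, hvc⟩ :=
      vehicleIntervention_apply P.C (P.epoch (i + 2)) hi' (h₀.1.trans h₀.2) σ'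
    rw [hscan] at hv hm hvc
    have htop : P.epoch (i + 3) ≤ P.m + 1 :=
      (P.epoch_le (by omega) (by omega) le_rfl).trans P.epoch_last.le
    set X := max (P.q (i + 2) - P.Q (i + 2)) (min a.x (P.q (i + 2))) with hX
    obtain ⟨hrec, hreccost⟩ := ih (by omega) (a.x - X) σ' (hσ.pred hi hag)
    have hsol := hrec.succ hi hF hS (fun G hd hδ => hG G hd htop hδ)
    set r' := globalBackwardRec P.C (i + 1) (a.x - X) σ' with hr'
    obtain ⟨c, hr, hcost⟩ : ∃ c, globalBackwardRec P.C (i + 2) δ σ =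
        ⟨a.L + r'.val, { r'.mem with x := Function.update r'.mem.x (i + 2) X }, c⟩ ∧
        c ≤ c₁ + c₂ + r'.cost + 20 := by
      rw [globalBackwardRec]
      have e₁ : readH (i + 1 + 1) σ = ⟨P.epoch (i + 2), σ, 1⟩ := by
        rw [← hσ.H (i + 2) (by omega) (by omega)]; rfl
      have e₂ : readH (i + 1 + 1 + 1) σ = ⟨P.epoch (i + 3), σ, 1⟩ := by
        rw [← hσ.H (i + 3) (by omega) le_rfl]; rfl
      have e₃ : readq (i + 1 + 1) σ' = ⟨P.q (i + 2), σ', 1⟩ := by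
        rw [← hσ.q (i + 2) (by omega) le_rfl, ← hag.q]; rfl
      have e₄ : readQ (i + 1 + 1) σ' = ⟨P.Q (i + 2), σ', 1⟩ := by
        rw [← hσ.Q (i + 2) (by omega) le_rfl, ← hag.Q]; rfl
      rw [RAM.bind_of_eq e₁, RAM.op_bind, RAM.bind_of_eq e₂, RAM.bind_of_eq haug,
        RAM.bind_of_eq e₃, RAM.bind_of_eq e₄, RAM.bind_apply, RAM.call_apply]
      dsimp only
      rw [hm, hv, RAM.op_bind, if_pos (by simp)]
      refine ⟨_, rfl, ?_⟩
      simp only [RAM.bind_apply, RAM.op_apply, RAM.call_apply, writeX]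
      dsimp only at hvc
      rw [← hr']
      omega
    intro r
    simp only [r]
    rw [hr]
    refine ⟨hsol, ?_⟩
    change c ≤ 100 * (P.epoch (i + 3) - P.epoch 1)
    omega

/-! ### The null trajectory and the conclusion -/

/-- The first loop of Global-Backward computes the null trajectory. -/
theorem rounds_nullStep {P : Problem} {σ : Store} (h₀ : σ.s 0 = P.s₀)
    (hd : ∀ h, 1 ≤ h → h ≤ P.m → σ.d h = P.d h) {n : ℕ} (hn : n ≤ P.m) :
    let r := rounds (fun h _ => nullStep P.C h) n 1 () σ
    r.mem.s 0 = P.nullStock 0 ∧ (∀ h, 1 ≤ h → h ≤ n → r.mem.NullAt P h) ∧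
      r.mem.d = σ.d ∧ r.mem.H = σ.H ∧ r.mem.q = σ.q ∧ r.mem.Q = σ.Q ∧ r.cost = 16 * n + 1 := by
  induction n with
  | zero => exact ⟨h₀, fun h h₁ h₂ => by omega, rfl, rfl, rfl, rfl, rfl⟩
  | succ n ih =>
    obtain ⟨i₀, iN, id, iH, iq, iQ, ic⟩ := ih (by omega)
    intro r
    simp only [r]
    rw [RAM.rounds_succ]
    simp only [nullStep_apply]
    generalize rounds (fun h _ => nullStep P.C h) n 1 () σ = ρ at *
    have hs : ρ.mem.s n = P.nullStock n := by
      rcases Nat.eq_zero_or_pos n with rfl | hpos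
      · exact i₀
      · exact (iN n hpos le_rfl).s
    have e : 1 + n - 1 = n := by omega
    have hv : ρ.mem.s (1 + n - 1) + ρ.mem.d (1 + n) = P.nullStock n + P.d (n + 1) := by
      rw [e, hs, id, hd (1 + n) (by omega) (by omega), add_comm 1 n]
    rw [hv]
    refine ⟨?_, fun h h₁ h₂ => ?_, id, iH, iq, iQ, by rw [ic]; ring⟩
    · rw [← i₀]
      exact Function.update_of_ne (by omega) _ _
    · rcases Nat.lt_or_ge n h with hlt | hge
      · obtain rfl : h = n + 1 := by omega
        rw [add_comm 1 n]
        refine ⟨?_, ?_, ?_⟩ <;> simp only [Store.setNull, Function.update_self]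
        · rw [Problem.nullStock_succ]
        · rw [Nat.add_sub_cancel]
        · rw [Nat.add_sub_cancel]
      · obtain ⟨k₁, k₂, k₃⟩ := iN h h₁ hge
        refine ⟨?_, ?_, ?_⟩ <;> simp only [Store.setNull] <;>
          rw [Function.update_of_ne (by omega)] <;> assumption

/-- Global-Backward solves stage `w` without any request, in linear time. -/
theorem globalBackward_solves {P : Problem} {σ : Store} (hσ : σ.Holds P) :
    let r := globalBackward P.m P.w P.C P.s₀ σ
    P.SolvesStage P.w 0 r.mem.x r.val ∧ r.cost ≤ 200 * P.m := by
  obtain ⟨hd, hv⟩ := hσ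
  let σ₁ : Store := { σ with
    H := Function.update σ.H (P.w + 1) (P.m + 1)
    s := Function.update σ.s 0 P.s₀ }
  obtain ⟨-, iN, -, iH, iq, iQ, ic⟩ := rounds_nullStep (P := P) (σ := σ₁) (n := P.m)
    (Function.update_self 0 P.s₀ σ.s) (fun h h₁ h₂ => hd h (Finset.mem_Icc.2 ⟨h₁, h₂⟩)) le_rfl
  set ρ := rounds (fun h _ => nullStep P.C h) P.m 1 () σ₁ with hρ
  obtain ⟨k, hk⟩ := Nat.exists_eq_add_of_le' P.one_le_w
  have hE := P.one_le_epoch le_rfl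
  have hlt := P.epoch_lt (i := 1) (j := P.w + 1) le_rfl (by omega) le_rfl
  rw [P.epoch_last] at hlt
  have hready : ρ.mem.Ready P (k + 1) := by
    rw [← hk]
    refine ⟨fun j h₁ hj => ?_, fun j h₁ hj => ?_, fun j h₁ hj => ?_, fun h h₁ hh => ?_⟩
    · rw [iH]
      rcases hj.eq_or_lt with rfl | hlt
      · rw [P.epoch_last]
        exact Function.update_self _ _ _
      · rw [P.epoch_of_le (by omega), ← (hv j (Finset.mem_Icc.2 ⟨h₁, by omega⟩)).1]
        exact Function.update_of_ne (by omega) _ _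
    · rw [iq]
      exact (hv j (Finset.mem_Icc.2 ⟨h₁, hj⟩)).2.1
    · rw [iQ]
      exact (hv j (Finset.mem_Icc.2 ⟨h₁, hj⟩)).2.2
    · rw [P.epoch_last] at hh
      exact iN h (by omega) (by omega)
  have hrec := globalBackwardRec_solves k hk.ge 0 ρ.mem hready
  rw [← hk, show k + 2 = P.w + 1 by omega, P.epoch_last] at hrec
  have hr : globalBackward P.m P.w P.C P.s₀ σ =
      ⟨(globalBackwardRec P.C P.w 0 ρ.mem).val, (globalBackwardRec P.C P.w 0 ρ.mem).mem,
        4 + (ρ.cost + (1 + (globalBackwardRec P.C P.w 0 ρ.mem).cost))⟩ := by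
    simp only [globalBackward, RAM.op_bind]
    rw [RAM.bind_of_eq (show writeH (P.w + 1) (P.m + 1) σ = ⟨(), _, 1⟩ from rfl),
      RAM.bind_of_eq (show writeS 0 P.s₀ _ = ⟨(), σ₁, 1⟩ from rfl), RAM.bind_apply,
      RAM.call_apply, forLoop, Nat.add_sub_cancel, ← hρ]
    congr 1
    dsimp only
    omega
  intro r
  simp only [r]
  rw [hr]
  refine ⟨hrec.1, ?_⟩
  dsimp only
  have := hrec.2
  omega

namespace Problem
variable {P : Problem}

theorem totalLoss_split {i : ℕ} (h₁ : 1 ≤ i) (hi : i ≤ P.w) (x : ℕ → ℝ) :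
    P.totalLoss x = P.lossOn 1 (P.epoch i - 1) x + P.lossOn (P.epoch i) P.m x := by
  have := P.epoch_lt h₁ (by omega : i < P.w + 1) le_rfl
  rw [P.epoch_last] at this
  exact P.lossOn_split (P.one_le_epoch h₁) (by omega) (P.one_le_epoch h₁) x

theorem lossJ_last (x : ℕ → ℝ) : P.lossJ P.w x = P.lossOn (P.epoch 1) P.m x := by
  rw [lossJ, P.lastEpoch_eq le_rfl, P.epoch_last, Nat.add_sub_cancel, P.epoch_of_le P.one_le_w]

theorem lossI_last (x : ℕ → ℝ) : P.lossI P.w x = P.lossOn (P.epoch P.w) P.m x := by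
  rw [lossI, P.lastEpoch_eq le_rfl, P.epoch_last, Nat.add_sub_cancel, P.epoch_of_le le_rfl]

theorem lossJ_add_lossI (x : ℕ → ℝ) :
    P.lossJ (P.w - 1) x + P.lossI P.w x = P.lossJ P.w x := by
  have hw := P.one_le_w
  have h₁ := P.epoch_le le_rfl hw (by omega)
  have h₂ := P.epoch_lt hw (by omega : P.w < P.w + 1) le_rfl
  rw [P.epoch_last] at h₂
  rw [lossJ_last, lossI_last, P.lossOn_split h₁ (by omega) (P.one_le_epoch hw), lossJ,
    P.lastEpoch_eq (by omega), Nat.sub_add_cancel hw, P.epoch_of_le hw]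

/-- A solution of the last stage without request is optimal: the losses before the first visit
are the same for all vectors. -/
theorem SolvesStage.isOptimal {x : ℕ → ℝ} {L : ℝ} (h : P.SolvesStage P.w 0 x L) :
    P.IsOptimal x ∧ L = P.lossJ P.w x := by
  have hcost : ∀ y, P.stageCost P.w 0 y = P.lossJ P.w y := fun y => by
    rw [stageCost, shortfall_zero, add_zero, lossJ_last, P.epoch_last, Nat.add_sub_cancel]
  have hL := h.eq
  rw [hcost] at hL
  refine ⟨⟨fun i hi => ?_, fun y hy => ?_⟩, hL⟩
  · rw [Finset.mem_Icc] at hi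
    exact h.admissible i hi.1 hi.2
  · have hle := h.le y fun j h₁ hj => hy j (Finset.mem_Icc.2 ⟨h₁, hj⟩)
    rw [hcost, hL, lossJ_last, lossJ_last] at hle
    have h₁ := P.one_le_epoch le_rfl
    rw [totalLoss_split le_rfl P.one_le_w, totalLoss_split le_rfl P.one_le_w,
      P.lossOn_congr le_rfl (by omega) (y := y) fun j _ _ => by omega]
    linarith

/-- Optimality implies optimality for the backward formulation, because the last intervention
does not affect the losses before its visit. -/
theorem IsOptimal.isBackwardOptimal {x : ℕ → ℝ} (h : P.IsOptimal x) : P.IsBackwardOptimal x := by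
  have hw := P.one_le_w
  have hEw := P.one_le_epoch hw
  have hE := P.one_le_epoch le_rfl
  refine ⟨⟨h.1, h.1 _ (Finset.mem_Icc.2 ⟨hw, le_rfl⟩), fun t ht => ?_⟩, fun y hy _ => ?_⟩
  · have hfeas : P.Feasible (Function.update x P.w t) := fun j hj => by
      rcases eq_or_ne j P.w with rfl | hne
      · rwa [Function.update_self]
      · rw [Function.update_of_ne hne]
        exact h.1 j hj
    have hle := h.2 _ hfeas
    rw [totalLoss_split hw le_rfl, totalLoss_split hw le_rfl,
      P.lossOn_congr hw (by omega) (x := Function.update x P.w t) (y := x)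
        fun j _ hj => Function.update_of_ne (by omega) _ _] at hle
    rw [lossI_last, lossI_last]
    linarith
  · have hle := h.2 y hy
    rw [totalLoss_split le_rfl hw, totalLoss_split le_rfl hw,
      P.lossOn_congr le_rfl (by omega) (y := y) fun j _ _ => by omega] at hle
    rw [lossJ_add_lossI, lossJ_add_lossI, lossJ_last, lossJ_last]
    linarith

theorem IntegerData.dataIn (h : P.IntegerData) : P.DataIn (Int.castAddHom ℝ).range := by
  obtain ⟨⟨c, hc⟩, ⟨s, hs⟩, hd, hv⟩ := h
  refine ⟨⟨c, hc.symm⟩, ⟨s, hs.symm⟩, fun k h₁ hk => ?_, fun i h₁ hi => ?_, fun i h₁ hi => ?_⟩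
  · obtain ⟨z, hz⟩ := hd k (Finset.mem_Icc.2 ⟨h₁, hk⟩)
    exact ⟨z, hz.symm⟩
  · obtain ⟨z, hz⟩ := (hv i (Finset.mem_Icc.2 ⟨h₁, hi⟩)).1
    exact ⟨z, hz.symm⟩
  · obtain ⟨z, hz⟩ := (hv i (Finset.mem_Icc.2 ⟨h₁, hi⟩)).2
    exact ⟨z, hz.symm⟩

end Problem
end BikeStation

/-- Global-Backward computes, in at most `K * m` steps, an optimal intervention vector, the minimal
loss on `[e 1, m]`, and leaves the final stock equal to that of the null vector; for integer data
the vector is an integer vector, optimal for the integer program. -/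
theorem mainTheorem3 :
    ∃ K : ℕ, ∀ (P : BikeStation.Problem) (σ : BikeStation.Store), σ.Holds P →
      let r := BikeStation.globalBackward P.m P.w P.C P.s₀ σ
      P.IsOptimal r.mem.x ∧
      P.IsBackwardOptimal r.mem.x ∧
      r.val = P.lossJ P.w r.mem.x ∧
      (P.IntegerData → P.IsIntegerOptimal r.mem.x) ∧
      P.stock r.mem.x P.m = P.stock (fun _ => 0) P.m ∧
      r.cost ≤ K * P.m := by
  -- at most `16 m` steps in the first loop, `100 m` in the recursion, and a constant overhead
  refine ⟨200, fun P σ hσ => ?_⟩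
  obtain ⟨hsol, hcost⟩ := BikeStation.globalBackward_solves hσ
  obtain ⟨hopt, hval⟩ := hsol.isOptimal
  refine ⟨hopt, hopt.isBackwardOptimal, hval, fun hint => ⟨⟨hopt.1, fun i hi => ?_⟩,
    fun y hy _ => hopt.2 y hy⟩, ?_, hcost⟩
  · rw [Finset.mem_Icc] at hi
    obtain ⟨z, hz⟩ := hsol.mem _ hint.dataIn (AddSubgroup.zero_mem _) i hi.1 hi.2
    exact ⟨z, hz.symm⟩
  · have h := hsol.stock
    rw [add_zero, Set.uIcc_self, P.epoch_last, Nat.add_sub_cancel] at h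
    exact h
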